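/- Let $0<\nu<1$, let $V:[0,1]\to\mathbb R$ be real analytic on $[0,1]$, and consider on $C_0^\infty((0,1))\subset L^2(0,1)$ (complex-valued functions) the symmetric operator $$A=-\partial_x^2+\frac{\nu^2-1/4}{x^2}+V(x),$$ with Hilbert space adjoint $A^\dagger$. Fix $\beta\in\mathbb R\cup\{\infty\}$ and for $\theta\in\mathbb R\cup\{\infty\}$ let $A^\theta$ be the restriction of $A^\dagger$ to those $\phi\in\mathcal D(A^\dagger)$ such that, for some $C\in\mathbb C$, as $x\to0^+$, $$\phi(x)=C\,(x^{-\nu+1/2}+\theta\,x^{\nu+1/2})+O(x^{3/2})\quad(\theta\in\mathbb R),\qquad \phi(x)=C\,x^{\nu+1/2}+O(x^{3/2})\quad(\theta=\infty),$$ and $\phi'(1)=\beta\phi(1)$ (meaning $\phi(1)=0$ if $\beta=\infty$). Let $\lambda\in\mathbb C$ be outside the spectra of $A^\infty$ and $A^0$. Then: 1. For $\theta=\infty,0$ the resolvent $(A^\theta-\lambda)^{-1}$ is an integral operator on $L^2(0,1)$ whose kernel $G_\theta(x,x',\lambda)$ is continuous on $(0,1]^2$ and satisfies $G_\theta(x,\cdot,\lambda)\in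 L^2(0,1)$ for each $x\in(0,1]$. For $x'\in(0,1]$ the limits $$G_\infty(x',\lambda)=\lim_{x\to0^+}x^{-\nu-1/2}G_\infty(x,x',\lambda),\qquad G_0(x',\lambda)=\lim_{x\to0^+}x^{\nu-1/2}G_0(x,x',\lambda)$$ exist and define functions in $L^2(0,1)$. For $f\in L^2(0,1)$ put $\phi^{\infty}(\lambda)=\int_0^1G_\infty(x',\lambda)f(x')\,dx'$ and $\phi^{0}(\lambda)=\int_0^1G_0(x',\lambda)f(x')\,dx'$. 2. There is a number $K(\lambda)\neq0$ with $\phi^0(\lambda)=K(\lambda)\,\phi^\infty(\lambda)$ for every $f\in L^2(0,1)$, and $\phi^\infty(\lambda)\ne0$ for some $f$; thus $K(\lambda)=\phi^0(\lambda)/\phi^\infty(\lambda)$, independently of $f$. It is read off from the behaviour of $G_\infty(x,\lambda)$ at the origin: $$G_\infty(x,\lambda)=\frac1{2\nu}\left(x^{-\nu+1/2}-K(\lambda)^{-1}x^{\nu+1/2}\right)+O(x^{3/2}),\qquad x\to0^+.$$ 3. For all $x,x'\in(0,1]$, $$G_0(x,x',\lambda)=G_\infty(x,x',\lambda)+2\nu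 K(\lambda)\,G_\infty(x,\lambda)\,G_\infty(x',\lambda),$$ and $(A^0-\lambda)^{-1}-(A^\infty-\lambda)^{-1}$ is of trace class. 4. For every $\theta\in\mathbb R$ such that $\lambda$ is also outside the spectrum of $A^\theta$: $K(\lambda)^{-1}+\theta\ne0$ and $1+\theta K(\lambda)\neq0$; the resolvent of $A^\theta$ has a kernel $G_\theta$ with the properties in 1, and for all $x,x'\in(0,1]$ $$G_\theta(x,x',\lambda)=G_\infty(x,x',\lambda)+2\nu\left(K(\lambda)^{-1}+\theta\right)^{-1}G_\infty(x,\lambda)\,G_\infty(x',\lambda);$$ the operator $(A^\theta-\lambda)^{-1}-(A^\infty-\lambda)^{-1}$ is of trace class, and $$\mathrm{Tr}\left\{(A^\theta-\lambda)^{-1}-(A^\infty-\lambda)^{-1}\right\}=\frac{\mathrm{Tr}\left\{(A^0-\lambda)^{-1}-(A^\infty-\lambda)^{-1}\right\}}{1+\theta K(\lambda)}.$$ -/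

import Mathlib

open MeasureTheory Set Filter Topology Asymptotics

namespace SingularSchrodinger

noncomputable section

/-- Lebesgue measure on the interval `(0,1)`. -/
abbrev μI : Measure ℝ := volume.restrict (Ioo (0 : ℝ) 1)

/-- The complex Hilbert space `L²(0,1)`. -/
abbrev L2I : Type := Lp ℂ 2 μI

/-! ### The minimal operator on `C₀^∞((0,1))` and its adjoint -/

/-- `φ ∈ C₀^∞((0,1))`. -/
def IsTestFunction (φ : ℝ → ℂ) : Prop :=
  ContDiff ℝ (⊤ : ℕ∞) φ ∧ HasCompactSupport φ ∧ tsupport φ ⊆ Ioo (0 : ℝ) 1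

/-- The differential expression `-φ'' + ((ν² - 1/4)/x² + V(x)) φ`. -/
def diffExpr (ν : ℝ) (V : ℝ → ℝ) (φ : ℝ → ℂ) (x : ℝ) : ℂ :=
  -deriv (deriv φ) x + (((ν ^ 2 - 1 / 4) / x ^ 2 + V x : ℝ) : ℂ) * φ x

theorem IsTestFunction.differentiable_deriv {φ : ℝ → ℂ} (h : IsTestFunction φ) :
    Differentiable ℝ φ ∧ Differentiable ℝ (deriv φ) := by
  have h2 : ContDiff ℝ 2 φ := h.1.of_le (WithTop.coe_le_coe.2 (le_top : (2 : ℕ∞) ≤ ⊤))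
  have h1 : ContDiff ℝ (1 + 1) φ := by simpa [one_add_one_eq_two] using h2
  exact ⟨h2.differentiable (by norm_num),
    ((contDiff_succ_iff_deriv.1 h1).2.2).differentiable (by norm_num)⟩

theorem diffExpr_add (ν : ℝ) (V : ℝ → ℝ) {φ ψ : ℝ → ℂ}
    (hφ : IsTestFunction φ) (hψ : IsTestFunction ψ) :
    diffExpr ν V (φ + ψ) = diffExpr ν V φ + diffExpr ν V ψ := by
  obtain ⟨a, b⟩ := hφ.differentiable_deriv
  obtain ⟨c, d⟩ := hψ.differentiable_deriv
  have e : deriv (φ + ψ) = deriv φ + deriv ψ := by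
    funext x
    exact deriv_add (a x) (c x)
  funext x
  have e2 : deriv (deriv φ + deriv ψ) x = deriv (deriv φ) x + deriv (deriv ψ) x :=
    deriv_add (b x) (d x)
  simp only [diffExpr, e, e2, Pi.add_apply]
  ring

theorem diffExpr_smul (ν : ℝ) (V : ℝ → ℝ) (c : ℂ) {φ : ℝ → ℂ} (hφ : IsTestFunction φ) :
    diffExpr ν V (c • φ) = c • diffExpr ν V φ := by
  obtain ⟨a, b⟩ := hφ.differentiable_deriv
  have e : deriv (c • φ) = c • deriv φ := by
    funext x
    exact deriv_const_smul c (a x)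
  funext x
  have e2 : deriv (c • deriv φ) x = c • deriv (deriv φ) x := deriv_const_smul c (b x)
  simp only [diffExpr, e, e2, Pi.smul_apply, smul_eq_mul]
  ring

/-- The graph of `A = -∂² + (ν² - 1/4)/x² + V` on the domain `C₀^∞((0,1)) ⊆ L²(0,1)`. -/
def minimalGraph (ν : ℝ) (V : ℝ → ℝ) : Submodule ℂ (L2I × L2I) where
  carrier := {p | ∃ φ : ℝ → ℂ, IsTestFunction φ ∧
    (p.1 : ℝ → ℂ) =ᵐ[μI] φ ∧ (p.2 : ℝ → ℂ) =ᵐ[μI] diffExpr ν V φ}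
  zero_mem' := by
    refine ⟨0, ⟨contDiff_const, HasCompactSupport.zero, by simp⟩, Lp.coeFn_zero _ _ _, ?_⟩
    have e : diffExpr ν V 0 = 0 := by
      have e1 : deriv (0 : ℝ → ℂ) = 0 := by
        funext x
        exact deriv_const x (0 : ℂ)
      funext x
      simp [diffExpr, e1]
    rw [e]
    exact Lp.coeFn_zero _ _ _
  add_mem' := by
    rintro p q ⟨φ, hφ, hp1, hp2⟩ ⟨ψ, hψ, hq1, hq2⟩
    refine ⟨φ + ψ, ⟨hφ.1.add hψ.1, hφ.2.1.add hψ.2.1, ?_⟩, ?_, ?_⟩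
    · exact (tsupport_add φ ψ).trans (union_subset hφ.2.2 hψ.2.2)
    · exact (Lp.coeFn_add _ _).trans (hp1.add hq1)
    · rw [diffExpr_add ν V hφ hψ]
      exact (Lp.coeFn_add _ _).trans (hp2.add hq2)
  smul_mem' := by
    rintro c p ⟨φ, hφ, hp1, hp2⟩
    refine ⟨c • φ, ⟨contDiff_const.smul hφ.1, hφ.2.1.smul_left (f := fun _ => c), ?_⟩, ?_, ?_⟩
    · exact (closure_mono (Function.support_const_smul_subset c φ)).trans hφ.2.2
    · exact (Lp.coeFn_smul _ _).trans (hp1.const_smul c)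
    · rw [diffExpr_smul ν V c hφ]
      exact (Lp.coeFn_smul _ _).trans (hp2.const_smul c)

/-- The symmetric operator `A = -∂² + (ν² - 1/4)/x² + V` on the domain `C₀^∞((0,1))`. -/
def minimalOperator (ν : ℝ) (V : ℝ → ℝ) : L2I →ₗ.[ℂ] L2I :=
  (minimalGraph ν V).toLinearPMap

/-- The graph of the minimal operator is `minimalGraph`. -/
theorem minimalOperator_graph (ν : ℝ) (V : ℝ → ℝ) :
    (minimalOperator ν V).graph = minimalGraph ν V := by
  refine Submodule.toLinearPMap_graph_eq _ ?_
  rintro p ⟨φ, hφ, h1, h2⟩ h0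
  have hz : φ =ᵐ[μI] 0 := h1.symm.trans (by rw [h0]; exact Lp.coeFn_zero _ _ _)
  have hφ0 : EqOn φ (0 : ℝ → ℂ) (Ioo 0 1) :=
    Measure.eqOn_open_of_ae_eq hz isOpen_Ioo hφ.1.continuous.continuousOn continuousOn_const
  have hd : EqOn (diffExpr ν V φ) (0 : ℝ → ℂ) (Ioo 0 1) := by
    intro x hx
    have e0 : φ =ᶠ[𝓝 x] fun _ => 0 :=
      Filter.eventually_of_mem (isOpen_Ioo.mem_nhds hx) hφ0
    have e1 : deriv (deriv φ) x = 0 := by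
      rw [e0.deriv.deriv_eq]
      simp
    simp [diffExpr, e1, hφ0 hx]
  refine Lp.ext (h2.trans (EventuallyEq.trans ?_ (Lp.coeFn_zero _ _ _).symm))
  exact (ae_restrict_mem measurableSet_Ioo).mono hd

/-- The maximal operator: the Hilbert space adjoint `A†` of the minimal operator. -/
def maximalOperator (ν : ℝ) (V : ℝ → ℝ) : L2I →ₗ.[ℂ] L2I :=
  (minimalOperator ν V).adjoint

/-! ### The extensions `A^θ_β`, `θ, β ∈ ℝ ∪ {∞}` -/

/-- The boundary condition at the singular point `0`:
`f(x) = C (x^(-ν+1/2) + θ x^(ν+1/2)) + O(x^(3/2))` for `θ ∈ ℝ`, and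
`f(x) = C x^(ν+1/2) + O(x^(3/2))` for `θ = ∞`, with some `C ∈ ℂ`. -/
def BoundaryAtZero (ν : ℝ) : OnePoint ℝ → (ℝ → ℂ) → Prop
  | OnePoint.infty, f => ∃ C : ℂ,
      (fun x : ℝ => f x - C * ((x ^ (ν + 1 / 2) : ℝ) : ℂ))
        =O[𝓝[>] 0] (fun x : ℝ => x ^ (3 / 2 : ℝ))
  | OnePoint.some θ, f => ∃ C : ℂ,
      (fun x : ℝ => f x - C * ((x ^ (-ν + 1 / 2) + θ * x ^ (ν + 1 / 2) : ℝ) : ℂ))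
        =O[𝓝[>] 0] (fun x : ℝ => x ^ (3 / 2 : ℝ))

/-- The boundary condition at the regular end point `1`: `f'(1) = β f(1)` (one-sided derivative)
for `β ∈ ℝ`, and `f(1) = 0` for `β = ∞`. -/
def BoundaryAtOne : OnePoint ℝ → (ℝ → ℂ) → Prop
  | OnePoint.infty, f => f 1 = 0
  | OnePoint.some β, f => HasDerivWithinAt f ((β : ℂ) * f 1) (Iic 1) 1

/-- The classes in `L²(0,1)` whose continuous representative on `(0,1]` satisfies both
boundary conditions. -/
def boundarySpace (ν : ℝ) (θ β : OnePoint ℝ) : Submodule ℂ L2I where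
  carrier := {u | ∃ f : ℝ → ℂ, (u : ℝ → ℂ) =ᵐ[μI] f ∧ ContinuousOn f (Ioc 0 1) ∧
    BoundaryAtZero ν θ f ∧ BoundaryAtOne β f}
  zero_mem' := by
    refine ⟨0, Lp.coeFn_zero _ _ _, continuousOn_const, ?_, ?_⟩
    · cases θ with
      | infty => exact ⟨0, by simpa using isBigO_zero _ _⟩
      | coe t => exact ⟨0, by simpa using isBigO_zero _ _⟩
    · cases β with
      | infty => rfl
      | coe b =>
        have h : HasDerivWithinAt (0 : ℝ → ℂ) 0 (Iic 1) 1 :=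
          hasDerivWithinAt_const (1 : ℝ) (Iic 1) (0 : ℂ)
        change HasDerivWithinAt (0 : ℝ → ℂ) ((b : ℂ) * 0) (Iic 1) 1
        rw [mul_zero]
        exact h
  add_mem' := by
    rintro u v ⟨f, hu, hf, hf0, hf1⟩ ⟨g, hv, hg, hg0, hg1⟩
    refine ⟨f + g, (Lp.coeFn_add _ _).trans (hu.add hv), hf.add hg, ?_, ?_⟩
    · cases θ with
      | infty =>
        obtain ⟨C, hC⟩ := hf0
        obtain ⟨D, hD⟩ := hg0
        refine ⟨C + D, (hC.add hD).congr_left fun x => ?_⟩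
        simp only [Pi.add_apply]
        ring
      | coe t =>
        obtain ⟨C, hC⟩ := hf0
        obtain ⟨D, hD⟩ := hg0
        refine ⟨C + D, (hC.add hD).congr_left fun x => ?_⟩
        simp only [Pi.add_apply]
        ring
    · cases β with
      | infty =>
        have h1 : f 1 = 0 := hf1
        have h2 : g 1 = 0 := hg1
        change f 1 + g 1 = 0
        rw [h1, h2, add_zero]
      | coe b =>
        have h := HasDerivWithinAt.add hf1 hg1
        rw [← mul_add] at h
        exact h
  smul_mem' := by
    rintro c u ⟨f, hu, hf, hf0, hf1⟩
    refine ⟨c • f, (Lp.coeFn_smul _ _).trans (hu.const_smul c), hf.const_smul c, ?_, ?_⟩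
    · cases θ with
      | infty =>
        obtain ⟨C, hC⟩ := hf0
        refine ⟨c * C, (hC.const_mul_left c).congr_left fun x => ?_⟩
        simp only [Pi.smul_apply, smul_eq_mul]
        ring
      | coe t =>
        obtain ⟨C, hC⟩ := hf0
        refine ⟨c * C, (hC.const_mul_left c).congr_left fun x => ?_⟩
        simp only [Pi.smul_apply, smul_eq_mul]
        ring
    · cases β with
      | infty =>
        have h1 : f 1 = 0 := hf1
        change c * f 1 = 0
        rw [h1, mul_zero]
      | coe b =>
        have h := HasDerivWithinAt.const_smul c hf1
        rw [smul_eq_mul, mul_left_comm] at h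
        exact h

/-- The extension `A^θ_β`: the restriction of `A†` to the functions in its domain that satisfy the
boundary conditions given by `θ` at `0` and by `β` at `1`. -/
def extensionOp (ν : ℝ) (V : ℝ → ℝ) (θ β : OnePoint ℝ) : L2I →ₗ.[ℂ] L2I :=
  (maximalOperator ν V).domRestrict (boundarySpace ν θ β)

/-! ### Resolvents and their kernels -/

/-- The bounded operator `R` is a two-sided inverse of `T - z`. -/
def IsResolventAt (T : L2I →ₗ.[ℂ] L2I) (z : ℂ) (R : L2I →L[ℂ] L2I) : Prop :=
  (∀ f : L2I, ∃ h : R f ∈ T.domain, T ⟨R f, h⟩ - z • R f = f) ∧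
    ∀ u : T.domain, R (T u - z • (u : L2I)) = u

/-- The resolvent set (the complement of the spectrum) of an unbounded operator. -/
def resolventPoints (T : L2I →ₗ.[ℂ] L2I) : Set ℂ := {z | ∃ R, IsResolventAt T z R}

open Classical in
/-- The resolvent `(T - z)⁻¹` for `z` in the resolvent set, and `0` otherwise. -/
def resolventOp (T : L2I →ₗ.[ℂ] L2I) (z : ℂ) : L2I →L[ℂ] L2I :=
  if h : ∃ R, IsResolventAt T z R then h.choose else 0

/-- `G` is the (continuous) integral kernel of the operator `R`. -/
structure IsIntegralKernel (R : L2I →L[ℂ] L2I) (G : ℝ → ℝ → ℂ) : Prop where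
  continuousOn : ContinuousOn (Function.uncurry G) (Ioc 0 1 ×ˢ Ioc 0 1)
  memLp : ∀ x ∈ Ioc (0 : ℝ) 1, MemLp (G x) 2 μI
  apply_ae : ∀ f : L2I, ∀ᵐ x ∂μI, R f x = ∫ x', G x x' * f x' ∂μI

/-- The resolvent `(A^θ_β - z)⁻¹`. -/
def extensionResolvent (ν : ℝ) (V : ℝ → ℝ) (θ β : OnePoint ℝ) (z : ℂ) : L2I →L[ℂ] L2I :=
  resolventOp (extensionOp ν V θ β) z

open Classical in
/-- The resolvent kernel `G_θ(x, x', z)` of `A^θ_β`, for `x, x' ∈ (0,1]`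
(and `0` if there is no continuous kernel). -/
def greenKernel (ν : ℝ) (V : ℝ → ℝ) (θ β : OnePoint ℝ) (z : ℂ) : ℝ → ℝ → ℂ :=
  if h : ∃ G, IsIntegralKernel (extensionResolvent ν V θ β z) G then h.choose else 0

/-- `G_∞(x', z) = lim_{x → 0⁺} x^(-ν-1/2) G_∞(x, x', z)`. -/
def boundaryKernelInf (ν : ℝ) (V : ℝ → ℝ) (β : OnePoint ℝ) (z : ℂ) (x' : ℝ) : ℂ :=
  limUnder (𝓝[>] (0 : ℝ)) fun x : ℝ =>
    ((x ^ (-ν - 1 / 2) : ℝ) : ℂ) * greenKernel ν V OnePoint.infty β z x x'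

/-- `G_0(x', z) = lim_{x → 0⁺} x^(ν-1/2) G_0(x, x', z)`. -/
def boundaryKernelZero (ν : ℝ) (V : ℝ → ℝ) (β : OnePoint ℝ) (z : ℂ) (x' : ℝ) : ℂ :=
  limUnder (𝓝[>] (0 : ℝ)) fun x : ℝ =>
    ((x ^ (ν - 1 / 2) : ℝ) : ℂ) * greenKernel ν V ((0 : ℝ) : OnePoint ℝ) β z x x'

/-- `φ^∞(z) = ∫₀¹ G_∞(x', z) f(x') dx'`. -/
def phiInf (ν : ℝ) (V : ℝ → ℝ) (β : OnePoint ℝ) (z : ℂ) (f : L2I) : ℂ :=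
  ∫ x', boundaryKernelInf ν V β z x' * f x' ∂μI

/-- `φ^0(z) = ∫₀¹ G_0(x', z) f(x') dx'`. -/
def phiZero (ν : ℝ) (V : ℝ → ℝ) (β : OnePoint ℝ) (z : ℂ) (f : L2I) : ℂ :=
  ∫ x', boundaryKernelZero ν V β z x' * f x' ∂μI

/-! ### Trace -/

/-- `T` is a trace class (nuclear) operator: `T = ∑ₙ ⟨aₙ, ·⟩ bₙ` with `∑ₙ ‖aₙ‖ ‖bₙ‖ < ∞`. -/
def IsTraceClass (T : L2I →L[ℂ] L2I) : Prop :=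
  ∃ a b : ℕ → L2I, Summable (fun n => ‖a n‖ * ‖b n‖) ∧
    ∀ u : L2I, HasSum (fun n => inner ℂ (a n) u • b n) (T u)

/-- An orthonormal basis of `L²(0,1)`. -/
def orthonormalBasis :
    HilbertBasis ((exists_hilbertBasis ℂ L2I).choose : Set L2I) ℂ L2I :=
  (exists_hilbertBasis ℂ L2I).choose_spec.choose

/-- The trace `∑ᵢ ⟨eᵢ, T eᵢ⟩` over an orthonormal basis
(for a trace class `T` it does not depend on the basis). -/
def operatorTrace (T : L2I →L[ℂ] L2I) : ℂ :=
  ∑' i, inner ℂ (orthonormalBasis i) (T (orthonormalBasis i))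

end

end SingularSchrodinger

open SingularSchrodinger

/-!
The proof identifies the resolvents explicitly. Put `q = V - z`. Writing a solution of
`u'' = ((ν² - 1/4)/x² + q) u` as `u = x^(σ+1/2) v` with `σ = ±ν` turns the equation into
`v'' + ((1+2σ)/x) v' = q v`, which is a Volterra equation with `v = 1 + O(x²)` because `1 + 2σ > -1`
(`exists_singular_solution`, `exists_frobenius_solution`). This gives solutions
`u₁ = x^(-ν+1/2) + O(x^(3/2))` and `u₂ = x^(ν+1/2) + O(x^(3/2))` with Wronskian `2ν`, and a nonzero
solution `χ = a u₁ + b u₂` satisfying the boundary condition at `1` (`FundamentalSystem`).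

If the Wronskian `2ν (a θ - b)` of `χ` and `u₁ + θ u₂` (or `2ν a`, for `θ = ∞`) vanished, `χ` would
be an eigenfunction of `A^θ`, which is impossible for `z` in the resolvent set
(`FundamentalSystem.W_ne_zero`). Otherwise variation of constants solves `(A^θ - z) u = f` in the
domain of `A^θ` for every test function `f`, and the resolvent applied to `f` must be this `u`. No
description of the whole domain of the adjoint is needed: integration by parts shows that the `u` at
hand belong to it (`mem_domain_maximalOperator`), and boundedness of the resolvent together with
density of the test functions gives the kernel for all `f` in `L²`
(`FundamentalSystem.isIntegralKernel_G`). Continuous kernels are unique (`IsIntegralKernel.eq`), so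
`greenKernel` is Green's function.

Hence `G_∞(x', z) = χ(x') / (2ν a)` and `G_0(x', z) = -χ(x') / (2ν b)`, so that `K = -a/b`. The
formula for `G_θ - G_∞` is an algebraic identity (`FundamentalSystem.G_eq_add`); the differences of
resolvents are multiples of one and the same rank one operator, so that the ratio of their traces is
the ratio of the coefficients.
-/

namespace SingularSchrodinger

noncomputable section

open scoped ComplexConjugate

/-! ### The Volterra equation at the singular end point -/

/-- The weighted mean `s^(-κ) ∫₀ˢ t^κ g(t) dt`, written as `s ∫₀¹ τ^κ g(sτ) dτ` so that it is
manifestly continuous in `s`, also at `s = 0`. -/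
def volterraMean (κ : ℝ) (g : ℝ → ℂ) (s : ℝ) : ℂ :=
  s • ∫ τ in (0 : ℝ)..1, τ ^ κ • g (s * τ)

theorem continuous_volterraMean {κ : ℝ} (hκ : -1 < κ) {g : ℝ → ℂ} (hg : Continuous g) {B : ℝ}
    (hB : ∀ x, ‖g x‖ ≤ B) : Continuous (volterraMean κ g) := by
  refine continuous_id.smul ?_
  refine intervalIntegral.continuous_of_dominated_interval (bound := fun τ => τ ^ κ * B) ?_ ?_ ?_ ?_
  · intro s
    have h1 : Measurable fun τ : ℝ => τ ^ κ := by fun_prop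
    exact h1.aestronglyMeasurable.smul (by fun_prop)
  · intro s
    refine Eventually.of_forall fun τ hτ => ?_
    rw [uIoc_of_le zero_le_one] at hτ
    rw [norm_smul, Real.norm_of_nonneg (Real.rpow_nonneg hτ.1.le _)]
    exact mul_le_mul_of_nonneg_left (hB _) (Real.rpow_nonneg hτ.1.le _)
  · exact (intervalIntegral.intervalIntegrable_rpow' hκ).mul_const B
  · refine Eventually.of_forall fun τ _ => ?_
    fun_prop

theorem norm_volterraMean_le {κ : ℝ} (hκ : -1 < κ) {g : ℝ → ℂ} {s A : ℝ} (hs : 0 ≤ s)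
    (hA : ∀ t ∈ Icc 0 s, ‖g t‖ ≤ A) : ‖volterraMean κ g s‖ ≤ s * (A / (κ + 1)) := by
  rw [volterraMean, norm_smul, Real.norm_of_nonneg hs]
  refine mul_le_mul_of_nonneg_left ?_ hs
  have h := intervalIntegral.norm_integral_le_of_norm_le (μ := volume) zero_le_one
    (f := fun τ : ℝ => τ ^ κ • g (s * τ)) (g := fun τ => τ ^ κ * A) ?_ ?_
  · refine h.trans (le_of_eq ?_)
    rw [intervalIntegral.integral_mul_const, integral_rpow (Or.inl hκ), Real.one_rpow,
      Real.zero_rpow (by linarith)]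
    ring
  · refine Eventually.of_forall fun τ hτ => ?_
    rw [norm_smul, Real.norm_of_nonneg (Real.rpow_nonneg hτ.1.le _)]
    refine mul_le_mul_of_nonneg_left (hA _ ⟨mul_nonneg hs hτ.1.le, ?_⟩) (Real.rpow_nonneg hτ.1.le _)
    exact mul_le_of_le_one_right hs hτ.2
  · exact (intervalIntegral.intervalIntegrable_rpow' hκ).mul_const A

/-- The form of the mean from which its derivative is computed. -/
theorem volterraMean_eq {κ : ℝ} {g : ℝ → ℂ} {s : ℝ} (hs : 0 < s) :
    volterraMean κ g s = s ^ (-κ) • ∫ t in (0 : ℝ)..s, t ^ κ • g t := by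
  have h := intervalIntegral.integral_comp_mul_left (a := 0) (b := 1)
    (fun t : ℝ => t ^ κ • g t) hs.ne'
  rw [mul_zero, mul_one] at h
  have h2 : (∫ t in (0 : ℝ)..s, t ^ κ • g t)
      = s • s ^ κ • ∫ τ in (0 : ℝ)..1, τ ^ κ • g (s * τ) := by
    rw [← intervalIntegral.integral_smul, ← inv_smul_eq_iff₀ hs.ne', ← h]
    refine intervalIntegral.integral_congr fun τ hτ => ?_
    rw [uIcc_of_le zero_le_one] at hτ
    simp only [Real.mul_rpow hs.le hτ.1, mul_smul]
  rw [h2, volterraMean, smul_comm s, ← mul_smul (s ^ (-κ)), ← Real.rpow_add hs]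
  simp

theorem hasDerivAt_volterraMean {κ : ℝ} (hκ : -1 < κ) {g : ℝ → ℂ} (hg : Continuous g) {s : ℝ}
    (hs : 0 < s) :
    HasDerivAt (volterraMean κ g) (g s - ((κ / s : ℝ) : ℂ) * volterraMean κ g s) s := by
  have hint : IntervalIntegrable (fun t : ℝ => t ^ κ • g t) volume 0 s := by
    have h := (intervalIntegral.intervalIntegrable_rpow' (a := 0) (b := s) hκ).smul_continuousOn
      (g := g) hg.continuousOn
    exact h
  have hmeas : StronglyMeasurable fun t : ℝ => t ^ κ • g t := by
    have h1 : Measurable fun τ : ℝ => τ ^ κ := by fun_prop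
    exact h1.stronglyMeasurable.smul hg.stronglyMeasurable
  have hF := intervalIntegral.integral_hasDerivAt_right hint
    (hmeas.stronglyMeasurableAtFilter) ((Real.continuousAt_rpow_const _ _ (Or.inl hs.ne')).smul
      hg.continuousAt)
  have hP := (Real.hasDerivAt_rpow_const (x := s) (p := -κ) (Or.inl hs.ne')).smul hF
  have hE : volterraMean κ g =ᶠ[𝓝 s] fun s => s ^ (-κ) • ∫ t in (0 : ℝ)..s, t ^ κ • g t :=
    (eventually_gt_nhds hs).mono fun t ht => volterraMean_eq ht
  refine (hP.congr_of_eventuallyEq hE).congr_deriv ?_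
  rw [volterraMean_eq hs, ← mul_smul, ← Real.rpow_add hs, neg_add_cancel, Real.rpow_zero, one_smul,
    Real.rpow_sub_one hs.ne']
  simp only [Complex.real_smul]
  push_cast
  ring

theorem volterraMean_sub {κ : ℝ} (hκ : -1 < κ) {g h : ℝ → ℂ} (hg : Continuous g)
    (hh : Continuous h) (s : ℝ) :
    volterraMean κ (fun x => g x - h x) s = volterraMean κ g s - volterraMean κ h s := by
  have hi : ∀ f : ℝ → ℂ, Continuous f →
      IntervalIntegrable (fun τ : ℝ => τ ^ κ • f (s * τ)) volume 0 1 := fun f hf =>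
    (intervalIntegral.intervalIntegrable_rpow' hκ).smul_continuousOn
      (hf.comp (continuous_const.mul continuous_id)).continuousOn
  simp only [volterraMean, smul_sub]
  rw [intervalIntegral.integral_sub (hi g hg) (hi h hh), smul_sub]

/-- The singular initial value problem `v'' + (κ/x) v' = q v`, `v(0) = 1`, `v'(0) = 0` is solvable
on `(0,1]` for every `κ > -1`. The Volterra operator is a contraction of `C([0,1])` in the norm
with weight `e^(-lx)` for large `l`. -/
theorem exists_singular_solution {κ : ℝ} (hκ : -1 < κ) {q : ℝ → ℂ}
    (hq : ContinuousOn q (Icc 0 1)) :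
    ∃ v v' : ℝ → ℂ, (∀ x, 0 < x → HasDerivAt v (v' x) x) ∧
      (∀ x ∈ Ioc (0 : ℝ) 1, HasDerivAt v' (q x * v x - ((κ / x : ℝ) : ℂ) * v' x) x) ∧
      ∃ C, ∀ x ∈ Ioc (0 : ℝ) 1, ‖v x - 1‖ ≤ C * x ^ 2 ∧ ‖v' x‖ ≤ C * x := by
  let Q : C(Icc (0 : ℝ) 1, ℂ) := ⟨fun x => q x, hq.domRestrict⟩
  set M : ℝ := ‖Q‖
  have hM : 0 ≤ M := norm_nonneg Q
  have hκ1 : 0 < κ + 1 := by linarith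
  set l : ℝ := 2 * (M / (κ + 1)) + 1 with hl
  have hMk : 0 ≤ M / (κ + 1) := by positivity
  have hl0 : 0 < l := by positivity
  let e : C(Icc (0 : ℝ) 1, ℂ) := ⟨fun x => ((Real.exp (l * x) : ℝ) : ℂ), by fun_prop⟩
  let g : C(Icc (0 : ℝ) 1, ℂ) → ℝ → ℂ := fun y => IccExtend zero_le_one (Q * e * y)
  have hgc : ∀ y, Continuous (g y) := fun y => (Q * e * y).continuous.Icc_extend'
  have hgb : ∀ y x, ‖g y x‖ ≤ ‖Q * e * y‖ := fun y x => (Q * e * y).norm_coe_le_norm _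
  have hge : ∀ y, ∀ x (hx : x ∈ Icc (0 : ℝ) 1),
      g y x = q x * ((Real.exp (l * x) : ℝ) : ℂ) * y ⟨x, hx⟩ := by
    intro y x hx
    change IccExtend zero_le_one (Q * e * y) x = _
    rw [IccExtend_of_mem _ _ hx]
    rfl
  have hwc : ∀ y, Continuous (volterraMean κ (g y)) := fun y =>
    continuous_volterraMean hκ (hgc y) (hgb y)
  let I : C(Icc (0 : ℝ) 1, ℂ) → ℝ → ℂ := fun y x => 1 + ∫ s in (0 : ℝ)..x, volterraMean κ (g y) s
  have hId : ∀ y x, HasDerivAt (I y) (volterraMean κ (g y) x) x := fun y x =>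
    ((hwc y).integral_hasStrictDerivAt 0 x).hasDerivAt.const_add 1
  have hIc : ∀ y, Continuous (I y) := fun y =>
    continuous_iff_continuousAt.2 fun x => (hId y x).continuousAt
  let Φ : C(Icc (0 : ℝ) 1, ℂ) → C(Icc (0 : ℝ) 1, ℂ) := fun y =>
    ⟨fun x => ((Real.exp (-(l * x)) : ℝ) : ℂ) * I y x, by
      have := hIc y
      fun_prop⟩
  have hQb : ∀ x (hx : x ∈ Icc (0 : ℝ) 1), ‖q x‖ ≤ M := fun x hx => Q.norm_coe_le_norm ⟨x, hx⟩
  have hcontr : ContractingWith (1 / 2) Φ := by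
    refine ⟨by norm_num, LipschitzWith.of_dist_le_mul fun y z => ?_⟩
    rw [ContinuousMap.dist_le (by positivity)]
    rintro ⟨x, hx⟩
    set D := dist y z
    have hD : 0 ≤ D := dist_nonneg
    have h1 : I y x - I z x = ∫ s in (0 : ℝ)..x, volterraMean κ (fun t => g y t - g z t) s := by
      simp only [volterraMean_sub hκ (hgc y) (hgc z)]
      rw [intervalIntegral.integral_sub ((hwc y).intervalIntegrable _ _)
        ((hwc z).intervalIntegrable _ _)]
      simp only [I]
      ring
    have h2 : ‖I y x - I z x‖ ≤ ∫ s in (0 : ℝ)..x, Real.exp (l * s) * (M * D / (κ + 1)) := by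
      rw [h1]
      refine intervalIntegral.norm_integral_le_of_norm_le hx.1 ?_
        (Continuous.intervalIntegrable (by fun_prop) _ _)
      refine Eventually.of_forall fun s hs => ?_
      have hs1 : s ≤ 1 := hs.2.trans hx.2
      refine (norm_volterraMean_le hκ hs.1.le (A := Real.exp (l * s) * (M * D)) ?_).trans ?_
      · intro t ht
        have ht1 : t ∈ Icc (0 : ℝ) 1 := ⟨ht.1, ht.2.trans hs1⟩
        rw [hge y t ht1, hge z t ht1, ← mul_sub, norm_mul, norm_mul, Complex.norm_real,
          Real.norm_of_nonneg (Real.exp_pos _).le]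
        have h3 : ‖y ⟨t, ht1⟩ - z ⟨t, ht1⟩‖ ≤ D := by
          rw [← dist_eq_norm]
          exact ContinuousMap.dist_apply_le_dist _
        have h4 : Real.exp (l * t) ≤ Real.exp (l * s) :=
          Real.exp_le_exp.2 (mul_le_mul_of_nonneg_left ht.2 hl0.le)
        calc ‖q t‖ * Real.exp (l * t) * ‖y ⟨t, ht1⟩ - z ⟨t, ht1⟩‖
            ≤ M * Real.exp (l * s) * D := by
              gcongr
              exact hQb t ht1
          _ = _ := by ring
      · have : 0 ≤ Real.exp (l * s) * (M * D) / (κ + 1) := by positivity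
        calc s * (Real.exp (l * s) * (M * D) / (κ + 1))
            ≤ 1 * (Real.exp (l * s) * (M * D) / (κ + 1)) := by gcongr
          _ = _ := by ring
    have h3 : ∫ s in (0 : ℝ)..x, Real.exp (l * s) = (Real.exp (l * x) - 1) / l := by
      rw [intervalIntegral.integral_comp_mul_left (fun s => Real.exp s) hl0.ne', integral_exp]
      simp [div_eq_inv_mul]
    rw [intervalIntegral.integral_mul_const, h3] at h2
    have h4 : M / (κ + 1) / l ≤ 1 / 2 := by
      rw [div_le_iff₀ hl0]
      linarith
    change dist (((Real.exp (-(l * x)) : ℝ) : ℂ) * I y x) (((Real.exp (-(l * x)) : ℝ) : ℂ) * I z x)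
      ≤ _
    rw [dist_eq_norm, ← mul_sub, norm_mul, Complex.norm_real,
      Real.norm_of_nonneg (Real.exp_pos _).le]
    calc Real.exp (-(l * x)) * ‖I y x - I z x‖
        ≤ Real.exp (-(l * x)) * ((Real.exp (l * x) - 1) / l * (M * D / (κ + 1))) := by gcongr
      _ ≤ Real.exp (-(l * x)) * (Real.exp (l * x) / l * (M * D / (κ + 1))) := by
          gcongr
          linarith
      _ = (Real.exp (-(l * x)) * Real.exp (l * x)) * (M / (κ + 1) / l) * D := by ring
      _ = M / (κ + 1) / l * D := by rw [← Real.exp_add]; simp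
      _ ≤ 1 / 2 * D := by gcongr
      _ = _ := by simp
  obtain ⟨y, hy⟩ : ∃ y, Φ y = y := ⟨_, hcontr.fixedPoint_isFixedPt⟩
  have hfix : ∀ x ∈ Icc (0 : ℝ) 1, g y x = q x * I y x := by
    intro x hx
    rw [hge y x hx]
    have h1 : y ⟨x, hx⟩ = ((Real.exp (-(l * x)) : ℝ) : ℂ) * I y x := by
      conv_lhs => rw [← hy]
      rfl
    rw [h1, mul_assoc, ← mul_assoc ((Real.exp (l * x) : ℝ) : ℂ), ← Complex.ofReal_mul,
      ← Real.exp_add]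
    simp
  set B := ‖Q * e * y‖
  have hB0 : 0 ≤ B := norm_nonneg _
  have hw : ∀ x, 0 ≤ x → ‖volterraMean κ (g y) x‖ ≤ x * (B / (κ + 1)) := fun x hx =>
    norm_volterraMean_le hκ hx fun t _ => hgb y t
  refine ⟨I y, volterraMean κ (g y), fun x _ => hId y x, ?_, B / (κ + 1), ?_⟩
  · intro x hx
    rw [← hfix x ⟨hx.1.le, hx.2⟩]
    exact hasDerivAt_volterraMean hκ (hgc y) hx.1
  · intro x hx
    refine ⟨?_, (hw x hx.1.le).trans (le_of_eq (mul_comm _ _))⟩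
    have h1 : I y x - 1 = ∫ s in (0 : ℝ)..x, volterraMean κ (g y) s := by simp [I]
    rw [h1]
    refine (intervalIntegral.norm_integral_le_of_norm_le_const
      (C := x * (B / (κ + 1))) fun s hs => ?_).trans (le_of_eq ?_)
    · rw [uIoc_of_le hx.1.le] at hs
      have hC : 0 ≤ B / (κ + 1) := by positivity
      exact (hw s hs.1.le).trans (mul_le_mul_of_nonneg_right hs.2 hC)
    · rw [sub_zero, abs_of_pos hx.1]
      ring

/-! ### Solutions of the homogeneous equation -/

/-- `u` solves `u'' = ((ν² - 1/4)/x² + q) u` on `(0,1]`, with derivative `u'`. At `x = 1` the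
derivatives are two-sided. -/
structure IsSolution (ν : ℝ) (q : ℝ → ℂ) (u u' : ℝ → ℂ) : Prop where
  hasDerivAt : ∀ x ∈ Ioc (0 : ℝ) 1, HasDerivAt u (u' x) x
  hasDerivAt_deriv : ∀ x ∈ Ioc (0 : ℝ) 1,
    HasDerivAt u' (((((ν ^ 2 - 1 / 4) / x ^ 2 : ℝ) : ℂ) + q x) * u x) x

theorem IsSolution.continuousOn {ν : ℝ} {q u u' : ℝ → ℂ} (h : IsSolution ν q u u') :
    ContinuousOn u (Ioc 0 1) := fun x hx => (h.hasDerivAt x hx).continuousAt.continuousWithinAt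

theorem IsSolution.linearCombination {ν : ℝ} {q u u' w w' : ℝ → ℂ} (hu : IsSolution ν q u u')
    (hw : IsSolution ν q w w') (a b : ℂ) :
    IsSolution ν q (fun x => a * u x + b * w x) (fun x => a * u' x + b * w' x) where
  hasDerivAt x hx := ((hu.hasDerivAt x hx).const_mul a).add ((hw.hasDerivAt x hx).const_mul b)
  hasDerivAt_deriv x hx := (((hu.hasDerivAt_deriv x hx).const_mul a).add
    ((hw.hasDerivAt_deriv x hx).const_mul b)).congr_deriv (by ring)

theorem IsSolution.wronskian_eq {ν : ℝ} {q u u' w w' : ℝ → ℂ} (hu : IsSolution ν q u u')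
    (hw : IsSolution ν q w w') {x : ℝ} (hx : x ∈ Ioc (0 : ℝ) 1) :
    u x * w' x - u' x * w x = u 1 * w' 1 - u' 1 * w 1 := by
  have hd : ∀ y ∈ Ioc (0 : ℝ) 1, HasDerivAt (fun y => u y * w' y - u' y * w y) 0 y := fun y hy =>
    (((hu.hasDerivAt y hy).mul (hw.hasDerivAt_deriv y hy)).sub
      ((hu.hasDerivAt_deriv y hy).mul (hw.hasDerivAt y hy))).congr_deriv (by ring)
  exact (constant_of_has_deriv_right_zero (a := x) (b := 1)
    (fun y hy => (hd y ⟨hx.1.trans_le hy.1, hy.2⟩).continuousAt.continuousWithinAt)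
    (fun y hy => (hd y ⟨hx.1.trans_le hy.1, hy.2.le⟩).hasDerivWithinAt) 1 ⟨hx.2, le_rfl⟩).symm

theorem hasDerivAt_ofReal_rpow (p : ℝ) {x : ℝ} (hx : 0 < x) :
    HasDerivAt (fun x : ℝ => ((x ^ p : ℝ) : ℂ)) ((p * x ^ (p - 1) : ℝ) : ℂ) x :=
  (Real.hasDerivAt_rpow_const (Or.inl hx.ne')).ofReal_comp

/-- The solution `x^(σ+1/2) (1 + O(x²))` for the exponent `σ = ±ν`, together with the leading
behaviour of its derivative. -/
theorem exists_frobenius_solution {ν σ : ℝ} (hσ : -1 < σ) (hσν : σ ^ 2 = ν ^ 2) {q : ℝ → ℂ}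
    (hq : ContinuousOn q (Icc 0 1)) :
    ∃ u u' : ℝ → ℂ, IsSolution ν q u u' ∧
      ((fun x : ℝ => u x - ((x ^ (σ + 1 / 2) : ℝ) : ℂ)) =O[𝓝[>] 0] fun x : ℝ => x ^ (3 / 2 : ℝ)) ∧
      Tendsto (fun x : ℝ => ((x ^ (-(σ + 1 / 2)) : ℝ) : ℂ) * u x) (𝓝[>] 0) (𝓝 1) ∧
      Tendsto (fun x : ℝ => ((x ^ (1 - (σ + 1 / 2)) : ℝ) : ℂ) * u' x) (𝓝[>] 0)
        (𝓝 ((σ + 1 / 2 : ℝ) : ℂ)) := by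
  obtain ⟨v, v', hv, hv', C, hC⟩ :=
    exists_singular_solution (κ := 1 + 2 * σ) (by linarith) hq
  set p : ℝ := σ + 1 / 2 with hp
  have hev : ∀ᶠ x in 𝓝[>] (0 : ℝ), x ∈ Ioc (0 : ℝ) 1 := Ioc_mem_nhdsGT one_pos
  have hid : Tendsto (fun x : ℝ => x) (𝓝[>] 0) (𝓝 0) := tendsto_nhdsWithin_of_tendsto_nhds tendsto_id
  have hvlim : Tendsto v (𝓝[>] 0) (𝓝 1) := by
    rw [tendsto_iff_norm_sub_tendsto_zero]
    refine squeeze_zero' (Eventually.of_forall fun _ => norm_nonneg _)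
      (hev.mono fun x hx => (hC x hx).1) ?_
    simpa using (hid.pow 2).const_mul C
  have hv'lim : Tendsto (fun x : ℝ => (x : ℂ) * v' x) (𝓝[>] 0) (𝓝 0) := by
    rw [tendsto_zero_iff_norm_tendsto_zero]
    refine squeeze_zero' (Eventually.of_forall fun _ => norm_nonneg _)
      (hev.mono fun x hx => ?_) (g := fun x => x * (C * x)) ?_
    · rw [norm_mul, Complex.norm_real, Real.norm_of_nonneg hx.1.le]
      exact mul_le_mul_of_nonneg_left (hC x hx).2 hx.1.le
    · simpa using hid.mul (hid.const_mul C)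
  refine ⟨fun x => ((x ^ p : ℝ) : ℂ) * v x,
    fun x => ((p * x ^ (p - 1) : ℝ) : ℂ) * v x + ((x ^ p : ℝ) : ℂ) * v' x, ⟨?_, ?_⟩, ?_, ?_, ?_⟩
  · intro x hx
    exact (hasDerivAt_ofReal_rpow p hx.1).mul (hv x hx.1)
  · intro x hx
    have h1 : HasDerivAt (fun x : ℝ => ((p * x ^ (p - 1) : ℝ) : ℂ))
        ((p * ((p - 1) * x ^ (p - 1 - 1)) : ℝ) : ℂ) x := by
      exact ((Real.hasDerivAt_rpow_const (Or.inl hx.1.ne')).const_mul p).ofReal_comp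
    refine ((h1.mul (hv x hx.1)).add
      ((hasDerivAt_ofReal_rpow p hx.1).mul (hv' x hx))).congr_deriv ?_
    have hx0 : (x : ℂ) ≠ 0 := by exact_mod_cast hx.1.ne'
    have hσν' : (ν : ℂ) ^ 2 = (σ : ℂ) ^ 2 := by exact_mod_cast hσν.symm
    rw [Real.rpow_sub_one hx.1.ne', Real.rpow_sub_one hx.1.ne', hp]
    push_cast
    rw [hσν']
    field_simp
    ring
  · refine IsBigO.of_bound C (hev.mono fun x hx => ?_)
    have hpx : 0 ≤ x ^ p := Real.rpow_nonneg hx.1.le _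
    have h1 : ((x ^ p : ℝ) : ℂ) * v x - ((x ^ p : ℝ) : ℂ) = ((x ^ p : ℝ) : ℂ) * (v x - 1) := by ring
    have hC0 : 0 ≤ C := by
      have h := (norm_nonneg _).trans (hC x hx).1
      exact nonneg_of_mul_nonneg_left h (pow_pos hx.1 2)
    rw [h1, norm_mul, Complex.norm_real, Real.norm_of_nonneg hpx,
      Real.norm_of_nonneg (Real.rpow_nonneg hx.1.le _)]
    calc x ^ p * ‖v x - 1‖ ≤ x ^ p * (C * x ^ 2) := by
          gcongr
          exact (hC x hx).1
      _ = C * x ^ (p + 2) := by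
          rw [Real.rpow_add hx.1 p 2, Real.rpow_two]
          ring
      _ ≤ C * x ^ (3 / 2 : ℝ) := by
          refine mul_le_mul_of_nonneg_left ?_ hC0
          exact Real.rpow_le_rpow_of_exponent_ge hx.1 hx.2 (by rw [hp]; linarith)
  · refine hvlim.congr' (hev.mono fun x hx => ?_)
    dsimp only
    rw [← mul_assoc, ← Complex.ofReal_mul, ← Real.rpow_add hx.1]
    simp
  · have h := (hvlim.const_mul (p : ℂ)).add hv'lim
    rw [mul_one, add_zero] at h
    refine h.congr' (hev.mono fun x hx => ?_)
    have e1 : x ^ (1 - p) * x ^ (p - 1) = 1 := by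
      rw [← Real.rpow_add hx.1]
      simp
    have e2 : x ^ (1 - p) * x ^ p = x := by
      rw [← Real.rpow_add hx.1]
      simp
    have e1' : ((x ^ (1 - p) : ℝ) : ℂ) * ((x ^ (p - 1) : ℝ) : ℂ) = 1 := by exact_mod_cast e1
    have e2' : ((x ^ (1 - p) : ℝ) : ℂ) * ((x ^ p : ℝ) : ℂ) = x := by exact_mod_cast e2
    dsimp only
    rw [mul_add, ← mul_assoc _ ((x ^ p : ℝ) : ℂ), e2', Complex.ofReal_mul]
    linear_combination (-(p : ℂ) * v x) * e1'

/-- A fundamental system for `u'' = ((ν² - 1/4)/x² + q) u` adapted to the end point `0`, and the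
solution `χ = a u₁ + b u₂` that satisfies the boundary condition at `1`. -/
structure FundamentalSystem (ν : ℝ) (q : ℝ → ℂ) (β : OnePoint ℝ) where
  /-- The solution `x^(-ν+1/2) + O(x^(3/2))`. -/
  u₁ : ℝ → ℂ
  /-- The derivative of `u₁`. -/
  u₁' : ℝ → ℂ
  /-- The solution `x^(ν+1/2) + O(x^(3/2))`. -/
  u₂ : ℝ → ℂ
  /-- The derivative of `u₂`. -/
  u₂' : ℝ → ℂ
  /-- The coefficient of `u₁` in the solution satisfying the boundary condition at `1`. -/
  a : ℂ
  /-- The coefficient of `u₂` in the solution satisfying the boundary condition at `1`. -/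
  b : ℂ
  sol₁ : IsSolution ν q u₁ u₁'
  sol₂ : IsSolution ν q u₂ u₂'
  isBigO₁ : (fun x : ℝ => u₁ x - ((x ^ (-ν + 1 / 2) : ℝ) : ℂ)) =O[𝓝[>] 0]
    fun x : ℝ => x ^ (3 / 2 : ℝ)
  isBigO₂ : (fun x : ℝ => u₂ x - ((x ^ (ν + 1 / 2) : ℝ) : ℂ)) =O[𝓝[>] 0]
    fun x : ℝ => x ^ (3 / 2 : ℝ)
  wronskian : ∀ x ∈ Ioc (0 : ℝ) 1, u₁ x * u₂' x - u₁' x * u₂ x = 2 * ν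
  tendsto₁ : Tendsto (fun x : ℝ => ((x ^ (ν - 1 / 2) : ℝ) : ℂ) * u₁ x) (𝓝[>] 0) (𝓝 1)
  tendsto₂ : Tendsto (fun x : ℝ => ((x ^ (-ν - 1 / 2) : ℝ) : ℂ) * u₂ x) (𝓝[>] 0) (𝓝 1)
  ne_zero : a ≠ 0 ∨ b ≠ 0
  boundaryAtOne : BoundaryAtOne β fun x => a * u₁ x + b * u₂ x

/-- The Wronskian of the two Frobenius solutions is constant, and their leading terms at `0` give
its value `2ν`. Since it does not vanish at `1`, the boundary condition at `1` is a nontrivial linear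
condition on the coefficients of `χ`. -/
theorem nonempty_fundamentalSystem {ν : ℝ} (hν0 : 0 < ν) (hν1 : ν < 1) {q : ℝ → ℂ}
    (hq : ContinuousOn q (Icc 0 1)) (β : OnePoint ℝ) : Nonempty (FundamentalSystem ν q β) := by
  obtain ⟨u, u', hu, huO, hul, hul'⟩ :=
    exists_frobenius_solution (ν := ν) (σ := -ν) (by linarith) (by ring) hq
  obtain ⟨w, w', hw, hwO, hwl, hwl'⟩ :=
    exists_frobenius_solution (ν := ν) (σ := ν) (by linarith) (by ring) hq
  have hev : ∀ᶠ x in 𝓝[>] (0 : ℝ), x ∈ Ioc (0 : ℝ) 1 := Ioc_mem_nhdsGT one_pos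
  have hlim : Tendsto (fun x : ℝ => u x * w' x - u' x * w x) (𝓝[>] 0) (𝓝 (2 * ν)) := by
    have h := (hul.mul hwl').sub (hul'.mul hwl)
    have e : (1 * ((ν + 1 / 2 : ℝ) : ℂ) - ((-ν + 1 / 2 : ℝ) : ℂ) * 1) = 2 * ν := by
      push_cast
      ring
    rw [e] at h
    refine h.congr' (hev.mono fun x hx => ?_)
    have e1 : x ^ (-(-ν + 1 / 2)) * x ^ (1 - (ν + 1 / 2)) = 1 := by
      rw [← Real.rpow_add hx.1]
      ring_nf
      simp
    have e2 : x ^ (1 - (-ν + 1 / 2)) * x ^ (-(ν + 1 / 2)) = 1 := by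
      rw [← Real.rpow_add hx.1]
      ring_nf
      simp
    have e1' : ((x ^ (-(-ν + 1 / 2)) : ℝ) : ℂ) * ((x ^ (1 - (ν + 1 / 2)) : ℝ) : ℂ) = 1 := by
      exact_mod_cast e1
    have e2' : ((x ^ (1 - (-ν + 1 / 2)) : ℝ) : ℂ) * ((x ^ (-(ν + 1 / 2)) : ℝ) : ℂ) = 1 := by
      exact_mod_cast e2
    linear_combination (u x * w' x) * e1' - (u' x * w x) * e2'
  have hW1 : u 1 * w' 1 - u' 1 * w 1 = 2 * ν :=
    tendsto_nhds_unique (tendsto_const_nhds.congr' (hev.mono fun x hx =>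
      (hu.wronskian_eq hw hx).symm)) hlim
  have hW : ∀ x ∈ Ioc (0 : ℝ) 1, u x * w' x - u' x * w x = 2 * ν := fun x hx =>
    (hu.wronskian_eq hw hx).trans hW1
  have hν : (ν : ℂ) ≠ 0 := by exact_mod_cast hν0.ne'
  have h1 : (1 : ℝ) ∈ Ioc (0 : ℝ) 1 := ⟨one_pos, le_rfl⟩
  obtain ⟨a, b, hab, hbc⟩ : ∃ a b : ℂ, (a ≠ 0 ∨ b ≠ 0) ∧
      BoundaryAtOne β fun x => a * u x + b * w x := by
    cases β with
    | infty =>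
      refine ⟨w 1, -u 1, ?_, ?_⟩
      · by_contra! h
        rw [h.1, neg_eq_zero.1 h.2] at hW1
        simp [hν] at hW1
      · change w 1 * u 1 + -u 1 * w 1 = 0
        ring
    | coe β =>
      refine ⟨w' 1 - β * w 1, -(u' 1 - β * u 1), ?_, ?_⟩
      · by_contra! h
        have e : (2 : ℂ) * ν = 0 := by
          rw [← hW1]
          linear_combination u 1 * h.1 + w 1 * h.2
        simp [hν] at e
      · have hd := (((hu.hasDerivAt 1 h1).const_mul (w' 1 - β * w 1)).add
          ((hw.hasDerivAt 1 h1).const_mul (-(u' 1 - β * u 1)))).hasDerivWithinAt (s := Iic 1)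
        exact hd.congr_deriv (by ring)
  refine ⟨⟨u, u', w, w', a, b, hu, hw, huO, hwO, hW, ?_, ?_, hab, hbc⟩⟩
  · refine hul.congr fun x => ?_
    ring_nf
  · refine hwl.congr fun x => ?_
    ring_nf

/-! ### Test functions -/

theorem IsTestFunction.exists_tsupport_subset_Icc {φ : ℝ → ℂ} (h : IsTestFunction φ) :
    ∃ c d : ℝ, 0 < c ∧ c ≤ d ∧ d < 1 ∧ tsupport φ ⊆ Icc c d := by
  have hK : IsCompact (tsupport φ) := h.2.1
  rcases (tsupport φ).eq_empty_or_nonempty with he | hne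
  · exact ⟨1 / 2, 1 / 2, by norm_num, le_rfl, by norm_num, by simp [he]⟩
  · obtain ⟨c, hc⟩ := hK.exists_isLeast hne
    obtain ⟨d, hd⟩ := hK.exists_isGreatest hne
    exact ⟨c, d, (h.2.2 hc.1).1, hc.2 hd.1, (h.2.2 hd.1).2, fun x hx => ⟨hc.2 hx, hd.2 hx⟩⟩

theorem memLp_of_continuousOn_of_eq_zero {f : ℝ → ℂ} (hf : ContinuousOn f (Ioo 0 1)) {c d : ℝ}
    (hc : 0 < c) (hd : d < 1) (h0 : ∀ x ∈ Ioo (0 : ℝ) 1, x ∉ Icc c d → f x = 0) :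
    MemLp f 2 μI := by
  obtain ⟨C, hC⟩ := (isCompact_Icc (a := c) (b := d)).exists_bound_of_continuousOn
    (hf.mono fun x hx => ⟨hc.trans_le hx.1, hx.2.trans_lt hd⟩)
  refine MemLp.of_bound (hf.aestronglyMeasurable measurableSet_Ioo) (max C 0) ?_
  filter_upwards [ae_restrict_mem measurableSet_Ioo] with x hx
  by_cases h : x ∈ Icc c d
  · exact (hC x h).trans (le_max_left _ _)
  · simp [h0 x hx h]

theorem IsTestFunction.memLp {φ : ℝ → ℂ} (h : IsTestFunction φ) : MemLp φ 2 μI := by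
  obtain ⟨c, d, hc, -, hd, hs⟩ := h.exists_tsupport_subset_Icc
  exact memLp_of_continuousOn_of_eq_zero h.1.continuous.continuousOn hc hd
    fun x _ hx => image_eq_zero_of_notMem_tsupport fun h' => hx (hs h')

theorem IsTestFunction.continuous_deriv_deriv {φ : ℝ → ℂ} (h : IsTestFunction φ) :
    Continuous (deriv (deriv φ)) := by
  have h2 : ContDiff ℝ 2 φ := h.1.of_le (WithTop.coe_le_coe.2 (le_top : (2 : ℕ∞) ≤ ⊤))
  have h1 : ContDiff ℝ (1 + 1) φ := by simpa [one_add_one_eq_two] using h2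
  exact ((contDiff_succ_iff_deriv.1 h1).2.2).continuous_deriv le_rfl

theorem IsTestFunction.deriv_deriv_eq_zero {φ : ℝ → ℂ} {x : ℝ} (hx : x ∉ tsupport φ) :
    deriv φ x = 0 ∧ deriv (deriv φ) x = 0 := by
  have e : φ =ᶠ[𝓝 x] fun _ => 0 := notMem_tsupport_iff_eventuallyEq.1 hx
  refine ⟨?_, ?_⟩
  · rw [e.deriv_eq]
    simp
  · rw [e.deriv.deriv_eq]
    simp

theorem continuousOn_potential {ν : ℝ} {V : ℝ → ℝ} (hV : ContinuousOn V (Icc 0 1)) :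
    ContinuousOn (fun x : ℝ => (((ν ^ 2 - 1 / 4) / x ^ 2 + V x : ℝ) : ℂ)) (Ioo 0 1) := by
  refine Complex.continuous_ofReal.comp_continuousOn ?_
  refine ContinuousOn.add (ContinuousOn.div continuousOn_const (by fun_prop) ?_)
    (hV.mono Ioo_subset_Icc_self)
  intro x hx
  exact pow_ne_zero 2 hx.1.ne'

theorem continuousOn_diffExpr {ν : ℝ} {V : ℝ → ℝ} (hV : ContinuousOn V (Icc 0 1)) {φ : ℝ → ℂ}
    (h : IsTestFunction φ) : ContinuousOn (diffExpr ν V φ) (Ioo 0 1) :=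
  h.continuous_deriv_deriv.neg.continuousOn.add
    ((continuousOn_potential hV).mul h.1.continuous.continuousOn)

theorem mem_domain_minimalOperator {ν : ℝ} {V : ℝ → ℝ} (hV : ContinuousOn V (Icc 0 1)) (u : L2I) :
    u ∈ (minimalOperator ν V).domain ↔
      ∃ φ : ℝ → ℂ, IsTestFunction φ ∧ (u : ℝ → ℂ) =ᵐ[μI] φ := by
  rw [LinearPMap.mem_domain_iff, minimalOperator_graph]
  constructor
  · rintro ⟨w, φ, hφ, h1, -⟩
    exact ⟨φ, hφ, h1⟩
  · rintro ⟨φ, hφ, h1⟩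
    obtain ⟨c, d, hc, -, hd, hs⟩ := hφ.exists_tsupport_subset_Icc
    have hm : MemLp (diffExpr ν V φ) 2 μI := by
      refine memLp_of_continuousOn_of_eq_zero (continuousOn_diffExpr hV hφ) hc hd fun x _ hx => ?_
      have hx' : x ∉ tsupport φ := fun h' => hx (hs h')
      simp [diffExpr, (IsTestFunction.deriv_deriv_eq_zero hx').2,
        image_eq_zero_of_notMem_tsupport hx']
    exact ⟨hm.toLp _, φ, hφ, h1, hm.coeFn_toLp⟩

theorem isTestFunction_ofReal {g : ℝ → ℝ} (hg : ContDiff ℝ (⊤ : ℕ∞) g) (hc : HasCompactSupport g)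
    (hs : tsupport g ⊆ Ioo 0 1) : IsTestFunction fun x => (g x : ℂ) := by
  refine ⟨Complex.ofRealCLM.contDiff.comp hg, hc.comp_left (g := ((↑) : ℝ → ℂ)) (by simp), ?_⟩
  exact (closure_mono (Function.support_comp_subset (g := ((↑) : ℝ → ℂ)) (by simp) g)).trans hs

/-- The domain is dense, so that `LinearPMap.adjoint` is the Hilbert space adjoint and not its
junk value. -/
theorem dense_domain_minimalOperator {ν : ℝ} {V : ℝ → ℝ} (hV : ContinuousOn V (Icc 0 1)) :
    Dense ((minimalOperator ν V).domain : Set L2I) := by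
  rw [Submodule.dense_iff_topologicalClosure_eq_top, Submodule.topologicalClosure_eq_top_iff,
    Submodule.eq_bot_iff]
  intro w hw
  have hw2 : MemLp w 2 μI := Lp.memLp w
  have h0 := isOpen_Ioo.ae_eq_zero_of_integral_contDiff_smul_eq_zero (f := (w : ℝ → ℂ)) (μ := μI)
    (U := Ioo (0 : ℝ) 1)
    ((hw2.integrable one_le_two).locallyIntegrable.locallyIntegrableOn _) ?_
  · refine Lp.ext (EventuallyEq.trans ?_ (Lp.coeFn_zero _ _ _).symm)
    filter_upwards [h0, ae_restrict_mem measurableSet_Ioo] with x hx hx'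
    exact hx hx'
  · intro g hg hc hs
    have hφ := isTestFunction_ofReal hg hc hs
    have hmem : hφ.memLp.toLp _ ∈ (minimalOperator ν V).domain :=
      (mem_domain_minimalOperator hV _).2 ⟨_, hφ, hφ.memLp.coeFn_toLp⟩
    have h := hw _ hmem
    rw [L2.inner_def] at h
    rw [← h]
    refine integral_congr_ae ?_
    filter_upwards [hφ.memLp.coeFn_toLp] with x hx
    rw [hx, RCLike.inner_apply, Complex.conj_ofReal, Complex.real_smul, mul_comm]

/-! ### Membership in the domains of the extensions -/

/-- Lagrange's identity: a twice differentiable function in `L²` with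
`-u'' + ((ν² - 1/4)/x² + V) u = h` lies in the domain of the adjoint. -/
theorem mem_domain_maximalOperator {ν : ℝ} {V : ℝ → ℝ} (hV : ContinuousOn V (Icc 0 1))
    {u u' h : ℝ → ℂ} {U H : L2I} (hU : (U : ℝ → ℂ) =ᵐ[μI] u) (hH : (H : ℝ → ℂ) =ᵐ[μI] h)
    (hh : ContinuousOn h (Ioo 0 1)) (hu : ∀ x ∈ Ioo (0 : ℝ) 1, HasDerivAt u (u' x) x)
    (hu' : ∀ x ∈ Ioo (0 : ℝ) 1,
      HasDerivAt u' ((((ν ^ 2 - 1 / 4) / x ^ 2 + V x : ℝ) : ℂ) * u x - h x) x) :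
    ∃ hm : U ∈ (maximalOperator ν V).domain, maximalOperator ν V ⟨U, hm⟩ = H := by
  have key : ∀ x : (minimalOperator ν V).domain,
      inner ℂ H (x : L2I) = inner ℂ U (minimalOperator ν V x) := by
    intro x
    have hg : ((x : L2I), minimalOperator ν V x) ∈ minimalGraph ν V := by
      rw [← minimalOperator_graph]
      exact (minimalOperator ν V).mem_graph x
    obtain ⟨φ, hφ, h1, h2⟩ := hg
    dsimp only at h1 h2
    set E : ℝ → ℂ := fun t => diffExpr ν V φ t * conj (u t) - φ t * conj (h t) with hE
    have hE0 : ∀ t ∉ tsupport φ, E t = 0 := fun t ht => by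
      simp [hE, diffExpr, (IsTestFunction.deriv_deriv_eq_zero ht).2,
        image_eq_zero_of_notMem_tsupport ht]
    obtain ⟨c, d, hc, -, hd, hs⟩ := hφ.exists_tsupport_subset_Icc
    have hus : ContinuousOn u (Ioo 0 1) := fun t ht =>
      (hu t ht).continuousAt.continuousWithinAt
    have hEc : ContinuousOn E (Ioo 0 1) :=
      ((continuousOn_diffExpr hV hφ).mul (Complex.continuous_conj.comp_continuousOn hus)).sub
        (hφ.1.continuous.continuousOn.mul (Complex.continuous_conj.comp_continuousOn hh))
    have hEm : MemLp E 2 μI := memLp_of_continuousOn_of_eq_zero hEc hc hd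
      fun t _ ht => hE0 t fun h' => ht (hs h')
    have hEi : IntervalIntegrable E volume 0 1 :=
      (intervalIntegrable_iff_integrableOn_Ioo_of_le zero_le_one).2 (hEm.integrable one_le_two)
    set P : ℝ → ℂ := fun t => φ t * conj (u' t) - deriv φ t * conj (u t) with hP
    have hP0 : ∀ t ∉ tsupport φ, P t = 0 := fun t ht => by
      simp [hP, (IsTestFunction.deriv_deriv_eq_zero ht).1, image_eq_zero_of_notMem_tsupport ht]
    have hPd : ∀ t, HasDerivAt P (E t) t := by
      intro t
      by_cases ht : t ∈ tsupport φ
      · have ht1 := hφ.2.2 ht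
        obtain ⟨d1, d2⟩ := hφ.differentiable_deriv
        have k1 := (d1 t).hasDerivAt.mul (hu' t ht1).star
        have k2 := (d2 t).hasDerivAt.mul (hu t ht1).star
        refine (k1.sub k2).congr_deriv ?_
        simp only [hE, diffExpr, star_sub, star_mul', RCLike.star_def, Complex.conj_ofReal]
        ring
      · rw [hE0 t ht]
        have e : P =ᶠ[𝓝 t] fun _ => 0 :=
          ((isClosed_tsupport φ).isOpen_compl.eventually_mem ht).mono fun s hs' => hP0 s hs'
        exact (hasDerivAt_const t (0 : ℂ)).congr_of_eventuallyEq e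
    have hint : ∫ t, E t ∂μI = 0 := by
      rw [← integral_Ioc_eq_integral_Ioo, ← intervalIntegral.integral_of_le zero_le_one,
        intervalIntegral.integral_eq_sub_of_hasDerivAt (fun t _ => hPd t) hEi,
        hP0 1 fun h' => (hφ.2.2 h').2.false, hP0 0 fun h' => (hφ.2.2 h').1.false, sub_zero]
    rw [eq_comm, ← sub_eq_zero, L2.inner_def, L2.inner_def,
      ← integral_sub (L2.integrable_inner _ _) (L2.integrable_inner _ _), ← hint]
    refine integral_congr_ae ?_
    filter_upwards [hU, hH, h1, h2] with t a1 a2 a3 a4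
    rw [a1, a2, a3, a4, RCLike.inner_apply, RCLike.inner_apply]
  have hm : U ∈ (maximalOperator ν V).domain :=
    LinearPMap.mem_adjoint_domain_of_exists _ ⟨H, key⟩
  exact ⟨hm, LinearPMap.adjoint_apply_eq (dense_domain_minimalOperator hV) ⟨U, hm⟩ key⟩

theorem mem_domain_extensionOp {ν : ℝ} {V : ℝ → ℝ} (hV : ContinuousOn V (Icc 0 1))
    {θ β : OnePoint ℝ} {u u' h : ℝ → ℂ} {U H : L2I} (hU : (U : ℝ → ℂ) =ᵐ[μI] u)
    (hH : (H : ℝ → ℂ) =ᵐ[μI] h) (hh : ContinuousOn h (Ioo 0 1))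
    (hu : ∀ x ∈ Ioo (0 : ℝ) 1, HasDerivAt u (u' x) x)
    (hu' : ∀ x ∈ Ioo (0 : ℝ) 1,
      HasDerivAt u' ((((ν ^ 2 - 1 / 4) / x ^ 2 + V x : ℝ) : ℂ) * u x - h x) x)
    (huc : ContinuousOn u (Ioc 0 1)) (h0 : BoundaryAtZero ν θ u) (h1 : BoundaryAtOne β u) :
    ∃ hm : U ∈ (extensionOp ν V θ β).domain, extensionOp ν V θ β ⟨U, hm⟩ = H := by
  obtain ⟨hm, e⟩ := mem_domain_maximalOperator hV hU hH hh hu hu'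
  refine ⟨⟨⟨u, hU, huc, h0, h1⟩, hm⟩, ?_⟩
  rw [← e]
  exact LinearPMap.domRestrict_apply rfl

theorem isResolventAt_resolventOp {T : L2I →ₗ.[ℂ] L2I} {z : ℂ} (h : z ∈ resolventPoints T) :
    IsResolventAt T z (resolventOp T z) := by
  have h' : ∃ R, IsResolventAt T z R := h
  rw [resolventOp, dif_pos h']
  exact h'.choose_spec

/-- Exhibiting one solution `U` of `(T - z) U = F` in the domain of `T` determines `R F`, because `R`
is a left inverse of `T - z`. -/
theorem IsResolventAt.apply_eq {T : L2I →ₗ.[ℂ] L2I} {z : ℂ} {R : L2I →L[ℂ] L2I}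
    (h : IsResolventAt T z R) {U F : L2I} (hm : U ∈ T.domain) (e : T ⟨U, hm⟩ = z • U + F) :
    R F = U := by
  have h2 := h.2 ⟨U, hm⟩
  rwa [e, add_sub_cancel_left] at h2

/-! ### Boundary conditions -/

theorem BoundaryAtZero.congr_const_mul {ν : ℝ} {θ : OnePoint ℝ} {f g : ℝ → ℂ} (c : ℂ)
    (hg : BoundaryAtZero ν θ g) (h : f =ᶠ[𝓝[>] 0] fun x => c * g x) : BoundaryAtZero ν θ f := by
  cases θ with
  | infty =>
    obtain ⟨C, hC⟩ := hg
    refine ⟨c * C, (hC.const_mul_left c).congr' (h.mono fun x hx => ?_) EventuallyEq.rfl⟩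
    dsimp only
    rw [hx]
    ring
  | coe t =>
    obtain ⟨C, hC⟩ := hg
    refine ⟨c * C, (hC.const_mul_left c).congr' (h.mono fun x hx => ?_) EventuallyEq.rfl⟩
    dsimp only
    rw [hx]
    ring

theorem BoundaryAtOne.congr_const_mul {β : OnePoint ℝ} {f g : ℝ → ℂ} (c : ℂ)
    (hg : BoundaryAtOne β g) (h : f =ᶠ[𝓝[≤] 1] fun x => c * g x) : BoundaryAtOne β f := by
  have h1 : f 1 = c * g 1 := h.self_of_nhdsWithin self_mem_Iic
  cases β with
  | infty =>
    have hg' : g 1 = 0 := hg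
    change f 1 = 0
    rw [h1, hg', mul_zero]
  | coe b =>
    have hg' : HasDerivWithinAt g ((b : ℂ) * g 1) (Iic 1) 1 := hg
    change HasDerivWithinAt f ((b : ℂ) * f 1) (Iic 1) 1
    rw [h1, mul_left_comm]
    exact (hg'.const_mul c).congr_of_eventuallyEq h h1

theorem memLp_of_isBigO_rpow {f : ℝ → ℂ} (hf : ContinuousOn f (Ioc 0 1)) {p : ℝ} (hp : -(1 / 2) < p)
    (hO : f =O[𝓝[>] 0] fun x : ℝ => x ^ p) : MemLp f 2 μI := by
  obtain ⟨C, hC⟩ := hO.bound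
  obtain ⟨δ, hδ, hδs⟩ := mem_nhdsGT_iff_exists_Ioo_subset.1 hC
  have hδ0 : 0 < δ := hδ
  obtain ⟨B, hB⟩ := (isCompact_Icc (a := δ) (b := 1)).exists_bound_of_continuousOn
    (hf.mono fun x hx => ⟨hδ0.trans_le hx.1, hx.2⟩)
  have hpow : MemLp (fun x : ℝ => x ^ p) 2 μI := by
    have hm : Measurable fun x : ℝ => x ^ p := by fun_prop
    rw [memLp_two_iff_integrable_sq hm.aestronglyMeasurable]
    have hi := (intervalIntegrable_iff_integrableOn_Ioo_of_le zero_le_one).1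
      (intervalIntegral.intervalIntegrable_rpow' (a := 0) (b := 1) (r := p * 2) (by linarith))
    refine hi.congr_fun (fun x hx => ?_) measurableSet_Ioo
    exact_mod_cast Real.rpow_mul hx.1.le p 2
  refine ((hpow.const_mul C).norm.add (memLp_const |B|)).of_le
    ((hf.mono Ioo_subset_Ioc_self).aestronglyMeasurable measurableSet_Ioo) ?_
  filter_upwards [ae_restrict_mem measurableSet_Ioo] with x hx
  refine le_trans ?_ (le_abs_self _)
  simp only [Pi.add_apply]
  rcases lt_or_ge x δ with h | h
  · have h1 : ‖f x‖ ≤ C * ‖x ^ p‖ := hδs ⟨hx.1, h⟩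
    have h2 : C * ‖x ^ p‖ ≤ ‖C * x ^ p‖ := by
      rw [norm_mul]
      exact mul_le_mul_of_nonneg_right (le_abs_self C) (norm_nonneg _)
    linarith [abs_nonneg B]
  · linarith [hB x ⟨h, hx.2.le⟩, le_abs_self B, norm_nonneg (C * x ^ p)]

theorem isBigO_rpow_of_sub {f : ℝ → ℂ} {p : ℝ} (hp : p ≤ 3 / 2)
    (hO : (fun x : ℝ => f x - ((x ^ p : ℝ) : ℂ)) =O[𝓝[>] 0] fun x : ℝ => x ^ (3 / 2 : ℝ)) :
    f =O[𝓝[>] 0] fun x : ℝ => x ^ p := by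
  have h1 : (fun x : ℝ => x ^ (3 / 2 : ℝ)) =O[𝓝[>] 0] fun x : ℝ => x ^ p := by
    refine IsBigO.of_bound 1 ?_
    have hev : ∀ᶠ x in 𝓝[>] (0 : ℝ), x ∈ Ioc (0 : ℝ) 1 := Ioc_mem_nhdsGT one_pos
    refine hev.mono fun x hx => ?_
    rw [one_mul, Real.norm_of_nonneg (Real.rpow_nonneg hx.1.le _),
      Real.norm_of_nonneg (Real.rpow_nonneg hx.1.le _)]
    exact Real.rpow_le_rpow_of_exponent_ge hx.1 hx.2 hp
  have h2 : (fun x : ℝ => ((x ^ p : ℝ) : ℂ)) =O[𝓝[>] 0] fun x : ℝ => x ^ p :=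
    IsBigO.of_bound 1 (Eventually.of_forall fun x => by simp)
  exact ((hO.trans h1).add h2).congr_left fun x => by ring

/-- The coefficient of `x^(-ν+1/2)` in the boundary condition `θ`. -/
def coeffNeg : OnePoint ℝ → ℂ
  | OnePoint.infty => 0
  | OnePoint.some _ => 1

/-- The coefficient of `x^(ν+1/2)` in the boundary condition `θ`. -/
def coeffPos : OnePoint ℝ → ℂ
  | OnePoint.infty => 1
  | OnePoint.some θ => θ

namespace FundamentalSystem

variable {ν : ℝ} {q : ℝ → ℂ} {β : OnePoint ℝ} (S : FundamentalSystem ν q β)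

/-- The solution that satisfies the boundary condition at `1`. -/
def χ (x : ℝ) : ℂ := S.a * S.u₁ x + S.b * S.u₂ x

/-- The derivative of `χ`. -/
def χ' (x : ℝ) : ℂ := S.a * S.u₁' x + S.b * S.u₂' x

/-- The solution that satisfies the boundary condition `θ` at `0`. -/
def w (θ : OnePoint ℝ) (x : ℝ) : ℂ := coeffNeg θ * S.u₁ x + coeffPos θ * S.u₂ x

/-- The derivative of `w θ`. -/
def w' (θ : OnePoint ℝ) (x : ℝ) : ℂ := coeffNeg θ * S.u₁' x + coeffPos θ * S.u₂' x

/-- The Wronskian `χ w' - χ' w` of `χ` and `w θ`. -/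
def W (θ : OnePoint ℝ) : ℂ := 2 * ν * (S.a * coeffPos θ - S.b * coeffNeg θ)

/-- Green's function `w θ (min x x') χ (max x x') / W θ`. -/
def G (θ : OnePoint ℝ) (x x' : ℝ) : ℂ := S.w θ (min x x') * S.χ (max x x') / S.W θ

theorem isSolution_χ : IsSolution ν q S.χ S.χ' := S.sol₁.linearCombination S.sol₂ _ _

theorem isSolution_w (θ : OnePoint ℝ) : IsSolution ν q (S.w θ) (S.w' θ) :=
  S.sol₁.linearCombination S.sol₂ _ _

theorem wronskian_χ_w (θ : OnePoint ℝ) {x : ℝ} (hx : x ∈ Ioc (0 : ℝ) 1) :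
    S.χ x * S.w' θ x - S.χ' x * S.w θ x = S.W θ := by
  simp only [χ, χ', w, w', W]
  rw [← S.wronskian x hx]
  ring

theorem boundaryAtZero_w (θ : OnePoint ℝ) : BoundaryAtZero ν θ (S.w θ) := by
  cases θ with
  | infty =>
    refine ⟨1, S.isBigO₂.congr_left fun x => ?_⟩
    change _ = 0 * S.u₁ x + 1 * S.u₂ x - _
    ring
  | coe t =>
    refine ⟨1, (S.isBigO₁.add (S.isBigO₂.const_mul_left (t : ℂ))).congr_left fun x => ?_⟩
    change _ = 1 * S.u₁ x + (t : ℂ) * S.u₂ x - _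
    push_cast
    ring

theorem memLp_linearCombination (hν0 : 0 < ν) (hν1 : ν < 1) (c d : ℂ) :
    MemLp (fun x => c * S.u₁ x + d * S.u₂ x) 2 μI :=
  ((memLp_of_isBigO_rpow S.sol₁.continuousOn (by linarith)
      (isBigO_rpow_of_sub (by linarith) S.isBigO₁)).const_mul c).add
    ((memLp_of_isBigO_rpow S.sol₂.continuousOn (by linarith)
      (isBigO_rpow_of_sub (by linarith) S.isBigO₂)).const_mul d)

theorem memLp_χ (hν0 : 0 < ν) (hν1 : ν < 1) : MemLp S.χ 2 μI :=
  S.memLp_linearCombination hν0 hν1 _ _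

theorem memLp_w (hν0 : 0 < ν) (hν1 : ν < 1) (θ : OnePoint ℝ) : MemLp (S.w θ) 2 μI :=
  S.memLp_linearCombination hν0 hν1 _ _

theorem not_ae_eq_zero_χ (hν0 : 0 < ν) : ¬ S.χ =ᵐ[μI] 0 := by
  intro h
  have h0 : EqOn S.χ (0 : ℝ → ℂ) (Ioo 0 1) := Measure.eqOn_open_of_ae_eq h isOpen_Ioo
    (S.isSolution_χ.continuousOn.mono Ioo_subset_Ioc_self) continuousOn_const
  have hx : (1 / 2 : ℝ) ∈ Ioo (0 : ℝ) 1 := by norm_num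
  have hx' := Ioo_subset_Ioc_self hx
  have h1 : S.χ (1 / 2) = 0 := h0 hx
  have h2 : S.χ' (1 / 2) = 0 := by
    have e : S.χ =ᶠ[𝓝 (1 / 2)] fun _ => 0 := Filter.eventually_of_mem (isOpen_Ioo.mem_nhds hx) h0
    exact ((S.isSolution_χ.hasDerivAt _ hx').congr_of_eventuallyEq e.symm).unique
      (hasDerivAt_const _ _)
  have hν : (2 * ν : ℂ) ≠ 0 := by
    simp [hν0.ne']
  have hW := S.wronskian _ hx'
  simp only [χ, χ'] at h1 h2
  have ha : 2 * ν * S.a = 0 := by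
    rw [← hW]
    linear_combination S.u₂' (1 / 2) * h1 - S.u₂ (1 / 2) * h2
  have hb : 2 * ν * S.b = 0 := by
    rw [← hW]
    linear_combination S.u₁ (1 / 2) * h2 - S.u₁' (1 / 2) * h1
  rcases S.ne_zero with h | h
  · exact h ((mul_eq_zero.1 ha).resolve_left hν)
  · exact h ((mul_eq_zero.1 hb).resolve_left hν)

theorem exists_χ_eq_const_mul_w {θ : OnePoint ℝ} (hν0 : 0 < ν) (h : S.W θ = 0) :
    ∃ c : ℂ, ∀ x, S.χ x = c * S.w θ x := by
  have hν : (2 * ν : ℂ) ≠ 0 := by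
    simp [hν0.ne']
  have h' := (mul_eq_zero.1 h).resolve_left hν
  cases θ with
  | infty =>
    refine ⟨S.b, fun x => ?_⟩
    change S.a * 1 - S.b * 0 = 0 at h'
    change S.a * S.u₁ x + S.b * S.u₂ x = S.b * (0 * S.u₁ x + 1 * S.u₂ x)
    linear_combination S.u₁ x * h'
  | coe t =>
    refine ⟨S.a, fun x => ?_⟩
    change S.a * t - S.b * 1 = 0 at h'
    change S.a * S.u₁ x + S.b * S.u₂ x = S.a * (1 * S.u₁ x + (t : ℂ) * S.u₂ x)
    linear_combination -S.u₂ x * h'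

end FundamentalSystem

/-- If the Wronskian vanished, `χ` would satisfy both boundary conditions and be an eigenfunction,
so `z` would not be in the resolvent set. -/
theorem FundamentalSystem.W_ne_zero {ν : ℝ} (hν0 : 0 < ν) (hν1 : ν < 1) {V : ℝ → ℝ}
    (hV : ContinuousOn V (Icc 0 1)) {θ β : OnePoint ℝ} {z : ℂ}
    (S : FundamentalSystem ν (fun x => V x - z) β)
    (hz : z ∈ resolventPoints (extensionOp ν V θ β)) : S.W θ ≠ 0 := by
  intro hW
  obtain ⟨c, hc⟩ := S.exists_χ_eq_const_mul_w hν0 hW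
  have hm := S.memLp_χ hν0 hν1
  obtain ⟨hmem, e⟩ := mem_domain_extensionOp hV (θ := θ) (β := β) (U := hm.toLp _)
    (H := z • hm.toLp _) (h := fun x => z * S.χ x) hm.coeFn_toLp
    ((Lp.coeFn_smul _ _).trans (hm.coeFn_toLp.mono fun x hx => by
      simp only [Pi.smul_apply, hx, smul_eq_mul]))
    ((continuousOn_const.mul S.isSolution_χ.continuousOn).mono Ioo_subset_Ioc_self)
    (fun x hx => S.isSolution_χ.hasDerivAt x (Ioo_subset_Ioc_self hx))
    (fun x hx => (S.isSolution_χ.hasDerivAt_deriv x (Ioo_subset_Ioc_self hx)).congr_deriv (by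
      push_cast
      ring))
    S.isSolution_χ.continuousOn
    ((S.boundaryAtZero_w θ).congr_const_mul c (Eventually.of_forall hc)) S.boundaryAtOne
  have h0 := (isResolventAt_resolventOp hz).apply_eq (F := 0) hmem (by rw [e, add_zero])
  rw [map_zero] at h0
  refine S.not_ae_eq_zero_χ hν0 ?_
  refine hm.coeFn_toLp.symm.trans ?_
  rw [← h0]
  exact Lp.coeFn_zero _ _ _

/-! ### The Green function is the resolvent kernel -/

theorem IsTestFunction.continuous_mul {f : ℝ → ℂ} (hf : IsTestFunction f) {g : ℝ → ℂ}
    (hg : ContinuousOn g (Ioc 0 1)) : Continuous fun x => g x * f x := by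
  refine continuous_iff_continuousAt.2 fun x => ?_
  by_cases hx : x ∈ tsupport f
  · have hx' := hf.2.2 hx
    exact ((hg.mono Ioo_subset_Ioc_self).continuousAt (isOpen_Ioo.mem_nhds hx')).mul
      hf.1.continuous.continuousAt
  · have e : (fun x => g x * f x) =ᶠ[𝓝 x] fun _ => 0 :=
      (notMem_tsupport_iff_eventuallyEq.1 hx).mono fun y hy => by simp [hy]
    exact continuousAt_const.congr e.symm

/-- Variation of constants: for a test function `f` the resolvent is given by Green's function. -/
theorem FundamentalSystem.resolvent_apply_testFunction {ν : ℝ} (hν0 : 0 < ν) (hν1 : ν < 1)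
    {V : ℝ → ℝ} (hV : ContinuousOn V (Icc 0 1)) {θ β : OnePoint ℝ} {z : ℂ}
    (S : FundamentalSystem ν (fun x => V x - z) β)
    (hz : z ∈ resolventPoints (extensionOp ν V θ β)) {f : ℝ → ℂ} (hf : IsTestFunction f) {F : L2I}
    (hF : (F : ℝ → ℂ) =ᵐ[μI] f) :
    extensionResolvent ν V θ β z F =ᵐ[μI] fun x => ∫ x', S.G θ x x' * F x' ∂μI := by
  have hW := S.W_ne_zero hν0 hν1 hV hz
  have hw := S.isSolution_w θ
  have hχ := S.isSolution_χ
  have hwf := hf.continuous_mul hw.continuousOn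
  have hχf := hf.continuous_mul hχ.continuousOn
  obtain ⟨c, d, hc, hcd, hd, hs⟩ := hf.exists_tsupport_subset_Icc
  have hf0 : ∀ x, x ∉ Icc c d → f x = 0 := fun x hx =>
    image_eq_zero_of_notMem_tsupport fun h' => hx (hs h')
  set F₁ : ℝ → ℂ := fun x => ∫ t in (0 : ℝ)..x, S.w θ t * f t
  set F₂ : ℝ → ℂ := fun x => ∫ t in x..1, S.χ t * f t
  have hF₁ : ∀ x, HasDerivAt F₁ (S.w θ x * f x) x := fun x =>
    (hwf.integral_hasStrictDerivAt 0 x).hasDerivAt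
  have hF₂ : ∀ x, HasDerivAt F₂ (-(S.χ x * f x)) x := fun x =>
    intervalIntegral.integral_hasDerivAt_left (hχf.intervalIntegrable _ _)
      hχf.stronglyMeasurable.stronglyMeasurableAtFilter hχf.continuousAt
  have hF₁c : Continuous F₁ := continuous_iff_continuousAt.2 fun x => (hF₁ x).continuousAt
  have hF₂c : Continuous F₂ := continuous_iff_continuousAt.2 fun x => (hF₂ x).continuousAt
  set g : ℝ → ℂ := fun x => (S.χ x * F₁ x + S.w θ x * F₂ x) / S.W θ with hg
  set g' : ℝ → ℂ := fun x => (S.χ' x * F₁ x + S.w' θ x * F₂ x) / S.W θ with hg'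
  have hgd : ∀ x ∈ Ioc (0 : ℝ) 1, HasDerivAt g (g' x) x := fun x hx =>
    ((((hχ.hasDerivAt x hx).mul (hF₁ x)).add ((hw.hasDerivAt x hx).mul (hF₂ x))).div_const
      _).congr_deriv (by
        simp only [hg']
        ring)
  have hgc : ContinuousOn g (Ioc 0 1) := fun x hx => (hgd x hx).continuousAt.continuousWithinAt
  have hgd' : ∀ x ∈ Ioc (0 : ℝ) 1,
      HasDerivAt g' ((((ν ^ 2 - 1 / 4) / x ^ 2 + V x : ℝ) : ℂ) * g x - (z * g x + f x)) x := by
    intro x hx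
    refine ((((hχ.hasDerivAt_deriv x hx).mul (hF₁ x)).add
      ((hw.hasDerivAt_deriv x hx).mul (hF₂ x))).div_const _).congr_deriv ?_
    rw [div_eq_iff hW]
    have e : g x * S.W θ = S.χ x * F₁ x + S.w θ x * F₂ x := div_mul_cancel₀ _ hW
    have e2 := S.wronskian_χ_w θ hx
    push_cast
    linear_combination (-((ν : ℂ) ^ 2 - 1 / 4) / x ^ 2 - (V x - z)) * e - f x * e2
  have hgm : MemLp g 2 μI := by
    have hb : ∀ {k H : ℝ → ℂ}, MemLp k 2 μI → Continuous H → MemLp (fun x => k x * H x) 2 μI := by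
      intro k H hk hH
      obtain ⟨B, hB⟩ := (isCompact_Icc (a := (0 : ℝ)) (b := 1)).exists_bound_of_continuousOn
        hH.continuousOn
      refine hk.of_le_mul (c := B) (hk.1.mul hH.aestronglyMeasurable) ?_
      filter_upwards [ae_restrict_mem measurableSet_Ioo] with x hx
      rw [norm_mul, mul_comm]
      exact mul_le_mul_of_nonneg_right (hB x (Ioo_subset_Icc_self hx)) (norm_nonneg _)
    have h := ((hb (S.memLp_χ hν0 hν1) hF₁c).add (hb (S.memLp_w hν0 hν1 θ) hF₂c)).mul_const
      (S.W θ)⁻¹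
    exact h
  have hg0 : BoundaryAtZero ν θ g := by
    refine (S.boundaryAtZero_w θ).congr_const_mul (F₂ 0 / S.W θ) ?_
    have hev : ∀ᶠ x in 𝓝[>] (0 : ℝ), x ∈ Ioo (0 : ℝ) c := Ioo_mem_nhdsGT hc
    refine hev.mono fun x hx => ?_
    have hz0 : ∀ k : ℝ → ℂ, ∫ t in (0 : ℝ)..x, k t * f t = 0 := fun k => by
      rw [intervalIntegral.integral_congr (g := fun _ => (0 : ℂ)), intervalIntegral.integral_zero]
      intro t ht
      rw [uIcc_of_le hx.1.le] at ht
      simp [hf0 t fun h' => (ht.2.trans_lt hx.2).not_ge h'.1]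
    have e1 : F₁ x = 0 := hz0 _
    have e2 : F₂ 0 = F₂ x := by
      have := intervalIntegral.integral_add_adjacent_intervals
        (hχf.intervalIntegrable (μ := volume) 0 x) (hχf.intervalIntegrable x 1)
      rw [hz0, zero_add] at this
      exact this.symm
    simp only [hg, e1, e2]
    ring
  have hg1 : BoundaryAtOne β g := by
    refine S.boundaryAtOne.congr_const_mul (F₁ 1 / S.W θ) ?_
    have hev : ∀ᶠ x in 𝓝[≤] (1 : ℝ), x ∈ Ioc d 1 := Ioc_mem_nhdsLE hd
    refine hev.mono fun x hx => ?_
    have hz0 : ∀ k : ℝ → ℂ, ∫ t in x..1, k t * f t = 0 := fun k => by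
      rw [intervalIntegral.integral_congr (g := fun _ => (0 : ℂ)), intervalIntegral.integral_zero]
      intro t ht
      rw [uIcc_of_le hx.2] at ht
      simp [hf0 t fun h' => (hx.1.trans_le ht.1).not_ge h'.2]
    have e1 : F₂ x = 0 := hz0 _
    have e2 : F₁ 1 = F₁ x := by
      have := intervalIntegral.integral_add_adjacent_intervals
        (hwf.intervalIntegrable (μ := volume) 0 x) (hwf.intervalIntegrable x 1)
      rw [hz0, add_zero] at this
      exact this.symm
    change (S.χ x * F₁ x + S.w θ x * F₂ x) / S.W θ = F₁ 1 / S.W θ * S.χ x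
    rw [e1, e2]
    ring
  obtain ⟨hmem, e⟩ := mem_domain_extensionOp hV (θ := θ) (β := β) (U := hgm.toLp _)
    (H := z • hgm.toLp _ + F) (h := fun x => z * g x + f x) hgm.coeFn_toLp
    (by
      filter_upwards [Lp.coeFn_add (z • hgm.toLp _) F, Lp.coeFn_smul z (hgm.toLp _),
        hgm.coeFn_toLp, hF] with x h1 h2 h3 h4
      rw [h1, Pi.add_apply, h2, Pi.smul_apply, h3, h4, smul_eq_mul])
    (((continuousOn_const.mul hgc).mono Ioo_subset_Ioc_self).add hf.1.continuous.continuousOn)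
    (fun x hx => hgd x (Ioo_subset_Ioc_self hx)) (fun x hx => hgd' x (Ioo_subset_Ioc_self hx))
    hgc hg0 hg1
  have hR : extensionResolvent ν V θ β z F = hgm.toLp _ :=
    (isResolventAt_resolventOp hz).apply_eq hmem e
  rw [hR]
  filter_upwards [hgm.coeFn_toLp, ae_restrict_mem measurableSet_Ioo] with x hx hxI
  rw [hx, integral_congr_ae (hF.mono fun t ht => by simp only [ht] :
    (fun x' => S.G θ x x' * F x') =ᵐ[μI] fun x' => S.G θ x x' * f x'),
    ← integral_Ioc_eq_integral_Ioo, ← intervalIntegral.integral_of_le zero_le_one]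
  have c1 : EqOn (fun t => S.G θ x t * f t) (fun t => S.χ x / S.W θ * (S.w θ t * f t))
      (uIcc 0 x) := by
    intro t ht
    rw [uIcc_of_le hxI.1.le] at ht
    simp only [FundamentalSystem.G, min_eq_right ht.2, max_eq_left ht.2]
    ring
  have c2 : EqOn (fun t => S.G θ x t * f t) (fun t => S.w θ x / S.W θ * (S.χ t * f t))
      (uIcc x 1) := by
    intro t ht
    rw [uIcc_of_le hxI.2.le] at ht
    simp only [FundamentalSystem.G, min_eq_left ht.1, max_eq_right ht.1]
    ring
  rw [← intervalIntegral.integral_add_adjacent_intervals (b := x)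
    (((hwf.const_mul _).intervalIntegrable 0 x).congr (c1.symm.mono uIoc_subset_uIcc))
    (((hχf.const_mul _).intervalIntegrable x 1).congr (c2.symm.mono uIoc_subset_uIcc)),
    intervalIntegral.integral_congr c1, intervalIntegral.integral_congr c2,
    intervalIntegral.integral_const_mul, intervalIntegral.integral_const_mul]
  simp only [hg, F₁, F₂]
  ring

theorem integral_mul_eq_inner {g : ℝ → ℂ} (hg : MemLp g 2 μI) (f : L2I) :
    ∫ x, g x * f x ∂μI = inner ℂ (hg.star.toLp _) f := by
  rw [L2.inner_def]
  refine integral_congr_ae ?_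
  filter_upwards [hg.star.coeFn_toLp] with x hx
  rw [hx, RCLike.inner_apply, Pi.star_apply, RCLike.star_def, Complex.conj_conj, mul_comm]

/-- `G θ x ·` is dominated by a multiple of `‖w θ‖ + ‖χ‖`. -/
theorem FundamentalSystem.memLp_G {ν : ℝ} (hν0 : 0 < ν) (hν1 : ν < 1) {q : ℝ → ℂ} {β : OnePoint ℝ}
    (S : FundamentalSystem ν q β) (θ : OnePoint ℝ) {x : ℝ} (hx : x ∈ Ioc (0 : ℝ) 1)
    (hc : ContinuousOn (Function.uncurry (S.G θ)) (Ioc 0 1 ×ˢ Ioc 0 1)) :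
    MemLp (S.G θ x) 2 μI := by
  have hcx : ContinuousOn (S.G θ x) (Ioo 0 1) :=
    hc.comp (f := fun t => (x, t)) (by fun_prop) fun t ht => ⟨hx, Ioo_subset_Ioc_self ht⟩
  refine ((S.memLp_w hν0 hν1 θ).norm.add (S.memLp_χ hν0 hν1).norm).of_le_mul
    (c := (‖S.χ x‖ + ‖S.w θ x‖) / ‖S.W θ‖) (hcx.aestronglyMeasurable measurableSet_Ioo) ?_
  refine Eventually.of_forall fun t => ?_
  have hn : ‖((fun t => ‖S.w θ t‖) + fun t => ‖S.χ t‖) t‖ = ‖S.w θ t‖ + ‖S.χ t‖ :=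
    Real.norm_of_nonneg (add_nonneg (norm_nonneg _) (norm_nonneg _))
  rw [hn, FundamentalSystem.G, norm_div, norm_mul, div_mul_eq_mul_div]
  refine div_le_div_of_nonneg_right ?_ (norm_nonneg _)
  rcases le_total t x with h | h
  · rw [min_eq_right h, max_eq_left h]
    nlinarith [norm_nonneg (S.w θ t), norm_nonneg (S.χ t), norm_nonneg (S.w θ x),
      norm_nonneg (S.χ x)]
  · rw [min_eq_left h, max_eq_right h]
    nlinarith [norm_nonneg (S.w θ t), norm_nonneg (S.χ t), norm_nonneg (S.w θ x),
      norm_nonneg (S.χ x)]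

/-- Both sides of `R f = ∫ G f` depend continuously on `f ∈ L²`, the left one in `L²` and hence
almost everywhere along a subsequence, the right one pointwise. So the identity extends from the
dense set of test functions. -/
theorem FundamentalSystem.isIntegralKernel_G {ν : ℝ} (hν0 : 0 < ν) (hν1 : ν < 1)
    {V : ℝ → ℝ} (hV : ContinuousOn V (Icc 0 1)) {θ β : OnePoint ℝ} {z : ℂ}
    (S : FundamentalSystem ν (fun x => V x - z) β)
    (hz : z ∈ resolventPoints (extensionOp ν V θ β)) :
    IsIntegralKernel (extensionResolvent ν V θ β z) (S.G θ) := by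
  have hc : ContinuousOn (Function.uncurry (S.G θ)) (Ioc 0 1 ×ˢ Ioc 0 1) := by
    refine ContinuousOn.div_const (ContinuousOn.mul ?_ ?_) _
    · exact (S.isSolution_w θ).continuousOn.comp (f := fun p : ℝ × ℝ => min p.1 p.2)
        (by fun_prop) fun p hp => ⟨lt_min hp.1.1 hp.2.1, (min_le_left _ _).trans hp.1.2⟩
    · exact S.isSolution_χ.continuousOn.comp (f := fun p : ℝ × ℝ => max p.1 p.2)
        (by fun_prop) fun p hp => ⟨lt_max_of_lt_left hp.1.1, max_le hp.1.2 hp.2.2⟩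
  refine ⟨hc, fun x hx => S.memLp_G hν0 hν1 θ hx hc, fun f => ?_⟩
  obtain ⟨F, hF, hFf⟩ := mem_closure_iff_seq_limit.1 (dense_domain_minimalOperator (ν := ν) hV f)
  have hRF : Tendsto (fun n => extensionResolvent ν V θ β z (F n)) atTop
      (𝓝 (extensionResolvent ν V θ β z f)) :=
    ((extensionResolvent ν V θ β z).continuous.tendsto f).comp hFf
  obtain ⟨ns, hns, hae⟩ := (tendstoInMeasure_of_tendsto_Lp hRF).exists_seq_tendsto_ae
  have hall : ∀ᵐ x ∂μI, ∀ n, extensionResolvent ν V θ β z (F n) x =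
      ∫ x', S.G θ x x' * F n x' ∂μI := by
    refine ae_all_iff.2 fun n => ?_
    obtain ⟨φ, hφ, h⟩ := (mem_domain_minimalOperator hV _).1 (hF n)
    exact S.resolvent_apply_testFunction hν0 hν1 hV hz hφ h
  filter_upwards [hae, hall, ae_restrict_mem measurableSet_Ioo] with x h1 h2 hx
  refine tendsto_nhds_unique h1 ?_
  simp only [h2, integral_mul_eq_inner (S.memLp_G hν0 hν1 θ (Ioo_subset_Ioc_self hx) hc)]
  exact (tendsto_const_nhds.inner hFf).comp hns.tendsto_atTop

/-- A continuous integral kernel is determined by its operator. -/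
theorem IsIntegralKernel.eq {R : L2I →L[ℂ] L2I} {G G' : ℝ → ℝ → ℂ} (h : IsIntegralKernel R G)
    (h' : IsIntegralKernel R G') {x x' : ℝ} (hx : x ∈ Ioc (0 : ℝ) 1) (hx' : x' ∈ Ioc (0 : ℝ) 1) :
    G x x' = G' x x' := by
  set D : ℝ → ℝ → ℂ := fun x x' => G x x' - G' x x' with hD
  have hDc : ContinuousOn (Function.uncurry D) (Ioc 0 1 ×ˢ Ioc 0 1) :=
    h.continuousOn.sub h'.continuousOn
  have hDm : ∀ x ∈ Ioc (0 : ℝ) 1, MemLp (D x) 2 μI := fun x hx => (h.memLp x hx).sub (h'.memLp x hx)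
  have hDt : ∀ φ : ℝ → ℂ, IsTestFunction φ → ∀ x ∈ Ioo (0 : ℝ) 1, ∫ t, D x t * φ t ∂μI = 0 := by
    intro φ hφ
    have hae : (fun x => ∫ t, D x t * φ t ∂μI) =ᵐ[μI] fun _ => 0 := by
      filter_upwards [h.apply_ae (hφ.memLp.toLp _), h'.apply_ae (hφ.memLp.toLp _),
        ae_restrict_mem measurableSet_Ioo] with x h1 h2 hx
      have hx' := Ioo_subset_Ioc_self hx
      have e : (fun t => D x t * φ t) =ᵐ[μI] fun t =>
          G x t * hφ.memLp.toLp _ t - G' x t * hφ.memLp.toLp _ t := by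
        filter_upwards [hφ.memLp.coeFn_toLp] with t ht
        rw [ht, hD]
        ring
      rw [integral_congr_ae e, integral_sub, ← h1, ← h2, sub_self]
      · exact (h.memLp x hx').integrable_mul (Lp.memLp _)
      · exact (h'.memLp x hx').integrable_mul (Lp.memLp _)
    have hcont : ContinuousOn (fun x => ∫ t, D x t * φ t ∂μI) (Ioo 0 1) := by
      refine continuousOn_integral_of_compact_support (k := tsupport φ) hφ.2.1 ?_ ?_
      · rintro ⟨x, t⟩ ⟨hx, -⟩
        refine ContinuousAt.continuousWithinAt ?_
        by_cases ht : t ∈ tsupport φ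
        · have h1 : ContinuousAt (Function.uncurry D) (x, t) :=
            (hDc.mono (prod_mono Ioo_subset_Ioc_self Ioo_subset_Ioc_self)).continuousAt
              ((isOpen_Ioo.prod isOpen_Ioo).mem_nhds ⟨hx, hφ.2.2 ht⟩)
          exact h1.mul (hφ.1.continuous.comp continuous_snd).continuousAt
        · have e : (Function.uncurry fun x t => D x t * φ t) =ᶠ[𝓝 (x, t)] fun _ => 0 := by
            have e1 : ∀ᶠ p : ℝ × ℝ in 𝓝 (x, t), φ p.2 = 0 :=
              (continuous_snd.tendsto (x, t)).eventually (notMem_tsupport_iff_eventuallyEq.1 ht)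
            refine e1.mono fun p hp => ?_
            simp only [Function.uncurry]
            rw [hp]
            simp
          exact continuousAt_const.congr e.symm
      · intro x t _ ht
        simp [image_eq_zero_of_notMem_tsupport ht]
    exact Measure.eqOn_open_of_ae_eq hae isOpen_Ioo hcont continuousOn_const
  have hD0 : EqOn (Function.uncurry D) (fun _ => 0) (Ioo 0 1 ×ˢ Ioo 0 1) := by
    rintro ⟨x, t⟩ ⟨hx, ht⟩
    have hx' := Ioo_subset_Ioc_self hx
    have h0 := isOpen_Ioo.ae_eq_zero_of_integral_contDiff_smul_eq_zero (f := D x) (μ := μI)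
      (U := Ioo (0 : ℝ) 1)
      (((hDm x hx').integrable one_le_two).locallyIntegrable.locallyIntegrableOn _)
      fun g hg hc hs => by
        rw [← hDt _ (isTestFunction_ofReal hg hc hs) x hx]
        exact integral_congr_ae (Eventually.of_forall fun t => by
          simp only [Complex.real_smul, mul_comm])
    have h1 : D x =ᵐ[μI] fun _ => 0 := by
      filter_upwards [h0, ae_restrict_mem measurableSet_Ioo] with t h2 h3
      exact h2 h3
    have hcx : ContinuousOn (D x) (Ioo 0 1) :=
      hDc.comp (f := fun t => (x, t)) (by fun_prop) fun t ht => ⟨hx', Ioo_subset_Ioc_self ht⟩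
    exact Measure.eqOn_open_of_ae_eq h1 isOpen_Ioo hcx continuousOn_const ht
  have h2 := hD0.of_subset_closure hDc continuousOn_const
    (prod_mono Ioo_subset_Ioc_self Ioo_subset_Ioc_self) (by
      rw [closure_prod_eq, closure_Ioo zero_ne_one]
      exact prod_mono Ioc_subset_Icc_self Ioc_subset_Icc_self)
  exact sub_eq_zero.1 (h2 (show (x, x') ∈ _ from ⟨hx, hx'⟩))

theorem isIntegralKernel_greenKernel {ν : ℝ} {V : ℝ → ℝ} {θ β : OnePoint ℝ} {z : ℂ}
    {G : ℝ → ℝ → ℂ} (h : IsIntegralKernel (extensionResolvent ν V θ β z) G) :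
    IsIntegralKernel (extensionResolvent ν V θ β z) (greenKernel ν V θ β z) := by
  have h' : ∃ G, IsIntegralKernel (extensionResolvent ν V θ β z) G := ⟨G, h⟩
  rw [greenKernel, dif_pos h']
  exact h'.choose_spec

/-! ### Rank one operators -/

theorem isTraceClass_of_apply_eq {T : L2I →L[ℂ] L2I} {a b : L2I}
    (h : ∀ f, T f = inner ℂ a f • b) : IsTraceClass T := by
  refine ⟨Pi.single 0 a, Pi.single 0 b, ?_, fun u => ?_⟩
  · refine summable_of_ne_finset_zero (s := {0}) fun n hn => ?_
    simp [Pi.single_eq_of_ne (Finset.notMem_singleton.1 hn)]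
  · rw [h u]
    convert hasSum_single (f := fun n => inner ℂ ((Pi.single 0 a : ℕ → L2I) n) u •
      (Pi.single 0 b : ℕ → L2I) n) 0 fun n hn => ?_ using 1
    · simp
    · simp [Pi.single_eq_of_ne hn]

theorem operatorTrace_eq_of_apply_eq {T T' : L2I →L[ℂ] L2I} {c : ℂ} (h : ∀ f, T f = c • T' f) :
    operatorTrace T = c * operatorTrace T' := by
  simp only [operatorTrace, h, inner_smul_right, tsum_mul_left]

/-- If the kernels of two operators differ by `c k(x) k(x')`, then the operators differ by the
rank one operator `f ↦ c ⟨conj k, f⟩ k`. -/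
theorem sub_apply_of_kernel_eq {R R' : L2I →L[ℂ] L2I} {G G' : ℝ → ℝ → ℂ}
    (h : IsIntegralKernel R G) (h' : IsIntegralKernel R' G') {k : ℝ → ℂ} (hk : MemLp k 2 μI)
    {c : ℂ} (hG : ∀ x ∈ Ioc (0 : ℝ) 1, ∀ x' ∈ Ioc (0 : ℝ) 1,
      G' x x' = G x x' + c * k x * k x') (f : L2I) :
    (R' - R) f = c • inner ℂ (hk.star.toLp _) f • hk.toLp _ := by
  refine Lp.ext ?_
  rw [← integral_mul_eq_inner hk]
  filter_upwards [h.apply_ae f, h'.apply_ae f, Lp.coeFn_sub (R' f) (R f),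
    Lp.coeFn_smul c ((∫ x, k x * f x ∂μI) • hk.toLp _),
    Lp.coeFn_smul (∫ x, k x * f x ∂μI) (hk.toLp _), hk.coeFn_toLp,
    ae_restrict_mem measurableSet_Ioo] with x h1 h2 h3 h4 h5 h6 hx
  have hx' := Ioo_subset_Ioc_self hx
  have hsub := integral_sub (f := fun t => G' x t * f t) (g := fun t => G x t * f t)
    ((h'.memLp x hx').integrable_mul (Lp.memLp f)) ((h.memLp x hx').integrable_mul (Lp.memLp f))
  rw [sub_apply, h3, h4, Pi.sub_apply, Pi.smul_apply, h5, Pi.smul_apply, h6,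
    h1, h2, ← hsub, smul_eq_mul, smul_eq_mul,
    mul_comm (∫ x, k x * f x ∂μI), ← mul_assoc, ← integral_const_mul]
  refine integral_congr_ae ?_
  filter_upwards [ae_restrict_mem measurableSet_Ioo] with t ht
  rw [hG x hx' t (Ioo_subset_Ioc_self ht)]
  ring

/-! ### The boundary kernels -/

/-- For `x < x'` the kernel factorizes, so its leading coefficient at `x = 0` is `χ(x') / W`. -/
theorem tendsto_greenKernel {ν : ℝ} {V : ℝ → ℝ} {θ β : OnePoint ℝ} {z : ℂ}
    (S : FundamentalSystem ν (fun x => V x - z) β)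
    (hG : ∀ x ∈ Ioc (0 : ℝ) 1, ∀ x' ∈ Ioc (0 : ℝ) 1, greenKernel ν V θ β z x x' = S.G θ x x')
    {p : ℝ} (hp : Tendsto (fun x : ℝ => ((x ^ p : ℝ) : ℂ) * S.w θ x) (𝓝[>] 0) (𝓝 1)) {x' : ℝ}
    (hx' : x' ∈ Ioc (0 : ℝ) 1) :
    Tendsto (fun x : ℝ => ((x ^ p : ℝ) : ℂ) * greenKernel ν V θ β z x x') (𝓝[>] 0)
      (𝓝 (S.χ x' / S.W θ)) := by
  have hev : ∀ᶠ x in 𝓝[>] (0 : ℝ), x ∈ Ioo (0 : ℝ) x' := Ioo_mem_nhdsGT hx'.1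
  have h := hp.mul_const (S.χ x' / S.W θ)
  rw [one_mul] at h
  refine h.congr' (hev.mono fun x hx => ?_)
  dsimp only
  rw [hG x ⟨hx.1, hx.2.le.trans hx'.2⟩ x' hx', FundamentalSystem.G, min_eq_left hx.2.le,
    max_eq_right hx.2.le]
  ring

/-- Krein's formula for Green's functions. It holds because
`χ = a w_θ - (a θ - b) u₂` with the solutions `w_θ` and `w_∞ = u₂` used to build the kernels. -/
theorem FundamentalSystem.G_eq_add {ν : ℝ} (hν0 : 0 < ν) {q : ℝ → ℂ} {β : OnePoint ℝ}
    (S : FundamentalSystem ν q β) (θ : ℝ) (ha : S.a ≠ 0) (hW : S.W (θ : OnePoint ℝ) ≠ 0)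
    (x x' : ℝ) :
    S.G (θ : OnePoint ℝ) x x' = S.G OnePoint.infty x x' +
      2 * ν * S.a / (S.a * θ - S.b) * (S.χ x / S.W OnePoint.infty) *
        (S.χ x' / S.W OnePoint.infty) := by
  have hν : (ν : ℂ) ≠ 0 := by exact_mod_cast hν0.ne'
  have e1 : S.W OnePoint.infty = 2 * ν * S.a := by
    change 2 * (ν : ℂ) * (S.a * 1 - S.b * 0) = _
    ring
  have e2 : S.W (θ : OnePoint ℝ) = 2 * ν * (S.a * θ - S.b) := by
    change 2 * (ν : ℂ) * (S.a * θ - S.b * 1) = _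
    ring
  have hd : S.a * θ - S.b ≠ 0 := fun h => hW (by rw [e2, h, mul_zero])
  have e3 : ∀ y, S.w OnePoint.infty y = S.u₂ y := fun y => by
    change 0 * S.u₁ y + 1 * S.u₂ y = _
    ring
  have e4 : ∀ y, S.w (θ : OnePoint ℝ) y = S.u₁ y + θ * S.u₂ y := fun y => by
    change 1 * S.u₁ y + θ * S.u₂ y = _
    ring
  have e5 : ∀ y y', S.χ x * S.χ x' = S.χ y * S.χ y' → S.χ y' * (S.u₁ y + θ * S.u₂ y) /
      (2 * ν * (S.a * θ - S.b)) = S.χ y' * S.u₂ y / (2 * ν * S.a) +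
      2 * ν * S.a / (S.a * θ - S.b) * (S.χ x / (2 * ν * S.a)) * (S.χ x' / (2 * ν * S.a)) := by
    intro y y' h
    -- `χ` is expressed through `w θ` and `u₂`.
    have key : S.χ y = S.a * (S.u₁ y + θ * S.u₂ y) - (S.a * θ - S.b) * S.u₂ y := by
      simp only [χ]
      ring
    generalize S.a * (θ : ℂ) - S.b = d at hd key ⊢
    have h2 : 2 * ν * S.a / d * (S.χ x / (2 * ν * S.a)) * (S.χ x' / (2 * ν * S.a)) =
        S.χ y * S.χ y' / (2 * ν * S.a * d) := by
      rw [← h]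
      field_simp
    rw [h2, key]
    field_simp
    ring
  simp only [G, e1, e2, e3, e4]
  rcases le_total x x' with h | h
  · rw [min_eq_left h, max_eq_right h, mul_comm _ (S.χ x'), mul_comm _ (S.χ x'), e5 x x' rfl]
  · rw [min_eq_right h, max_eq_left h, mul_comm _ (S.χ x), mul_comm _ (S.χ x),
      e5 x' x (mul_comm _ _)]

end

end SingularSchrodinger

open SingularSchrodinger
theorem mainTheorem2 (ν : ℝ) (hν0 : 0 < ν) (hν1 : ν < 1)
    (V : ℝ → ℝ) (hV : AnalyticOnNhd ℝ V (Icc 0 1)) (β : OnePoint ℝ) (z : ℂ)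
    (hinf : z ∈ resolventPoints (extensionOp ν V OnePoint.infty β))
    (hzero : z ∈ resolventPoints (extensionOp ν V ((0 : ℝ) : OnePoint ℝ) β)) :
    -- the resolvents of `A^∞` and `A^0` have continuous kernels
    IsIntegralKernel (extensionResolvent ν V OnePoint.infty β z)
      (greenKernel ν V OnePoint.infty β z) ∧
    IsIntegralKernel (extensionResolvent ν V ((0 : ℝ) : OnePoint ℝ) β z)
      (greenKernel ν V ((0 : ℝ) : OnePoint ℝ) β z) ∧
    -- the limits that define `G_∞(x', z)` and `G_0(x', z)` exist
    (∀ x' ∈ Ioc (0 : ℝ) 1, Tendsto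
      (fun x : ℝ => ((x ^ (-ν - 1 / 2) : ℝ) : ℂ) * greenKernel ν V OnePoint.infty β z x x')
      (𝓝[>] 0) (𝓝 (boundaryKernelInf ν V β z x'))) ∧
    (∀ x' ∈ Ioc (0 : ℝ) 1, Tendsto
      (fun x : ℝ =>
        ((x ^ (ν - 1 / 2) : ℝ) : ℂ) * greenKernel ν V ((0 : ℝ) : OnePoint ℝ) β z x x')
      (𝓝[>] 0) (𝓝 (boundaryKernelZero ν V β z x'))) ∧
    MemLp (boundaryKernelInf ν V β z) 2 μI ∧
    MemLp (boundaryKernelZero ν V β z) 2 μI ∧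
    ∃ K : ℂ, K ≠ 0 ∧
      -- `K = φ^0 / φ^∞`, independently of `f`
      (∃ f : L2I, phiInf ν V β z f ≠ 0) ∧
      (∀ f : L2I, phiZero ν V β z f = K * phiInf ν V β z f) ∧
      -- `K` is read off from the behaviour of `G_∞(x, z)` at the origin
      (fun x : ℝ => boundaryKernelInf ν V β z x -
          1 / (2 * (ν : ℂ)) *
            (((x ^ (-ν + 1 / 2) : ℝ) : ℂ) - K⁻¹ * ((x ^ (ν + 1 / 2) : ℝ) : ℂ)))
        =O[𝓝[>] 0] (fun x : ℝ => x ^ (3 / 2 : ℝ)) ∧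
      -- the relation between the kernels for `θ = 0` and `θ = ∞`
      (∀ x ∈ Ioc (0 : ℝ) 1, ∀ x' ∈ Ioc (0 : ℝ) 1,
        greenKernel ν V ((0 : ℝ) : OnePoint ℝ) β z x x' =
          greenKernel ν V OnePoint.infty β z x x' +
            2 * (ν : ℂ) * K * boundaryKernelInf ν V β z x * boundaryKernelInf ν V β z x') ∧
      IsTraceClass (extensionResolvent ν V ((0 : ℝ) : OnePoint ℝ) β z -
        extensionResolvent ν V OnePoint.infty β z) ∧
      -- the relation between the kernels for general `θ`, and the trace formula
      ∀ θ : ℝ, z ∈ resolventPoints (extensionOp ν V (θ : OnePoint ℝ) β) →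
        K⁻¹ + (θ : ℂ) ≠ 0 ∧ 1 + (θ : ℂ) * K ≠ 0 ∧
        IsIntegralKernel (extensionResolvent ν V (θ : OnePoint ℝ) β z)
          (greenKernel ν V (θ : OnePoint ℝ) β z) ∧
        (∀ x ∈ Ioc (0 : ℝ) 1, ∀ x' ∈ Ioc (0 : ℝ) 1,
          greenKernel ν V (θ : OnePoint ℝ) β z x x' =
            greenKernel ν V OnePoint.infty β z x x' +
              2 * (ν : ℂ) * (K⁻¹ + (θ : ℂ))⁻¹ *
                boundaryKernelInf ν V β z x * boundaryKernelInf ν V β z x') ∧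
        IsTraceClass (extensionResolvent ν V (θ : OnePoint ℝ) β z -
          extensionResolvent ν V OnePoint.infty β z) ∧
        operatorTrace (extensionResolvent ν V (θ : OnePoint ℝ) β z -
            extensionResolvent ν V OnePoint.infty β z) =
          operatorTrace (extensionResolvent ν V ((0 : ℝ) : OnePoint ℝ) β z -
            extensionResolvent ν V OnePoint.infty β z) / (1 + (θ : ℂ) * K) := by
  have hVc : ContinuousOn V (Icc 0 1) := hV.continuousOn
  have hν : (ν : ℂ) ≠ 0 := by exact_mod_cast hν0.ne'
  obtain ⟨S⟩ := nonempty_fundamentalSystem hν0 hν1 (q := fun x => (V x : ℂ) - z)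
    ((Complex.continuous_ofReal.comp_continuousOn hVc).sub continuousOn_const) β
  have hker : ∀ {θ : OnePoint ℝ}, z ∈ resolventPoints (extensionOp ν V θ β) →
      IsIntegralKernel (extensionResolvent ν V θ β z) (greenKernel ν V θ β z) := fun hz =>
    isIntegralKernel_greenKernel (S.isIntegralKernel_G hν0 hν1 hVc hz)
  have hGeq : ∀ {θ : OnePoint ℝ}, z ∈ resolventPoints (extensionOp ν V θ β) →
      ∀ x ∈ Ioc (0 : ℝ) 1, ∀ x' ∈ Ioc (0 : ℝ) 1, greenKernel ν V θ β z x x' = S.G θ x x' :=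
    fun hz x hx x' hx' => (hker hz).eq (S.isIntegralKernel_G hν0 hν1 hVc hz) hx hx'
  have hWinf := S.W_ne_zero hν0 hν1 hVc hinf
  have hW0 := S.W_ne_zero hν0 hν1 hVc hzero
  have eWinf : S.W OnePoint.infty = 2 * ν * S.a := by
    change 2 * (ν : ℂ) * (S.a * 1 - S.b * 0) = _
    ring
  have eW : ∀ θ : ℝ, S.W (θ : OnePoint ℝ) = 2 * ν * (S.a * θ - S.b) := fun θ => by
    change 2 * (ν : ℂ) * (S.a * θ - S.b * 1) = _
    ring
  have ha : S.a ≠ 0 := fun h => hWinf (by rw [eWinf, h, mul_zero])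
  have hb : S.b ≠ 0 := fun h => hW0 (by rw [eW, h]; simp)
  have tinf : ∀ x' ∈ Ioc (0 : ℝ) 1, Tendsto
      (fun x : ℝ => ((x ^ (-ν - 1 / 2) : ℝ) : ℂ) * greenKernel ν V OnePoint.infty β z x x')
      (𝓝[>] 0) (𝓝 (S.χ x' / S.W OnePoint.infty)) := fun x' hx' =>
    tendsto_greenKernel S (hGeq hinf) (S.tendsto₂.congr fun x => by
      change _ = _ * (0 * S.u₁ x + 1 * S.u₂ x)
      ring) hx'
  have tzero : ∀ x' ∈ Ioc (0 : ℝ) 1, Tendsto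
      (fun x : ℝ =>
        ((x ^ (ν - 1 / 2) : ℝ) : ℂ) * greenKernel ν V ((0 : ℝ) : OnePoint ℝ) β z x x')
      (𝓝[>] 0) (𝓝 (S.χ x' / S.W ((0 : ℝ) : OnePoint ℝ))) := fun x' hx' =>
    tendsto_greenKernel S (hGeq hzero) (S.tendsto₁.congr fun x => by
      change _ = _ * (1 * S.u₁ x + ((0 : ℝ) : ℂ) * S.u₂ x)
      push_cast
      ring) hx'
  have einf : ∀ x' ∈ Ioc (0 : ℝ) 1, boundaryKernelInf ν V β z x' = S.χ x' / S.W OnePoint.infty :=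
    fun x' hx' => (tinf x' hx').limUnder_eq
  have ezero : ∀ x' ∈ Ioc (0 : ℝ) 1,
      boundaryKernelZero ν V β z x' = S.χ x' / S.W ((0 : ℝ) : OnePoint ℝ) :=
    fun x' hx' => (tzero x' hx').limUnder_eq
  have hχm : ∀ c : ℂ, MemLp (fun x => S.χ x / c) 2 μI := fun c => by
    simpa only [div_eq_mul_inv] using (S.memLp_χ hν0 hν1).mul_const c⁻¹
  have aeinf : (fun x' => S.χ x' / S.W OnePoint.infty) =ᵐ[μI] boundaryKernelInf ν V β z :=
    (ae_restrict_mem measurableSet_Ioo).mono fun x hx => (einf x (Ioo_subset_Ioc_self hx)).symm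
  have aezero : (fun x' => S.χ x' / S.W ((0 : ℝ) : OnePoint ℝ)) =ᵐ[μI]
      boundaryKernelZero ν V β z :=
    (ae_restrict_mem measurableSet_Ioo).mono fun x hx => (ezero x (Ioo_subset_Ioc_self hx)).symm
  have minf : MemLp (boundaryKernelInf ν V β z) 2 μI := (hχm _).ae_eq aeinf
  have mzero : MemLp (boundaryKernelZero ν V β z) 2 μI := (hχm _).ae_eq aezero
  set K : ℂ := -(S.a / S.b) with hK
  have hK0 : K ≠ 0 := neg_ne_zero.2 (div_ne_zero ha hb)
  have hKinv : K⁻¹ = -(S.b / S.a) := by rw [hK, inv_neg, inv_div]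
  -- Krein's formula, for all admissible `θ` including `θ = 0`.
  have krein : ∀ θ : ℝ, z ∈ resolventPoints (extensionOp ν V (θ : OnePoint ℝ) β) →
      K⁻¹ + (θ : ℂ) ≠ 0 ∧ ∀ x ∈ Ioc (0 : ℝ) 1, ∀ x' ∈ Ioc (0 : ℝ) 1,
        greenKernel ν V (θ : OnePoint ℝ) β z x x' = greenKernel ν V OnePoint.infty β z x x' +
          2 * (ν : ℂ) * (K⁻¹ + (θ : ℂ))⁻¹ *
            boundaryKernelInf ν V β z x * boundaryKernelInf ν V β z x' := by
    intro θ hz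
    have hWθ := S.W_ne_zero hν0 hν1 hVc hz
    have hd : S.a * θ - S.b ≠ 0 := fun h => hWθ (by rw [eW, h, mul_zero])
    have e : K⁻¹ + (θ : ℂ) = (S.a * θ - S.b) / S.a := by
      rw [hKinv]
      field_simp
      ring
    refine ⟨by rw [e]; exact div_ne_zero hd ha, fun x hx x' hx' => ?_⟩
    rw [hGeq hz x hx x' hx', hGeq hinf x hx x' hx', einf x hx, einf x' hx',
      S.G_eq_add hν0 θ ha hWθ, e, inv_div, mul_div_assoc (2 * (ν : ℂ))]
  have hrank : ∀ θ : ℝ, z ∈ resolventPoints (extensionOp ν V (θ : OnePoint ℝ) β) → ∀ f : L2I,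
      (extensionResolvent ν V (θ : OnePoint ℝ) β z - extensionResolvent ν V OnePoint.infty β z) f =
        (2 * (ν : ℂ) * (K⁻¹ + (θ : ℂ))⁻¹) • inner ℂ (minf.star.toLp _) f • minf.toLp _ :=
    fun θ hz f => sub_apply_of_kernel_eq (hker hinf) (hker hz) minf (krein θ hz).2 f
  have htrace : ∀ θ : ℝ, z ∈ resolventPoints (extensionOp ν V (θ : OnePoint ℝ) β) →
      IsTraceClass (extensionResolvent ν V (θ : OnePoint ℝ) β z -
        extensionResolvent ν V OnePoint.infty β z) := fun θ hz =>
    isTraceClass_of_apply_eq (a := minf.star.toLp _)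
      (b := (2 * (ν : ℂ) * (K⁻¹ + (θ : ℂ))⁻¹) • minf.toLp _) fun f => by
        rw [hrank θ hz f, smul_comm]
  have hK0' : (K⁻¹ + ((0 : ℝ) : ℂ))⁻¹ = K := by simp
  refine ⟨hker hinf, hker hzero, fun x' hx' => ?_, fun x' hx' => ?_, minf, mzero, K, hK0, ?_, ?_,
    ?_, ?_, htrace 0 hzero, fun θ hz => ?_⟩
  · rw [einf x' hx']
    exact tinf x' hx'
  · rw [ezero x' hx']
    exact tzero x' hx'
  · -- Testing against the complex conjugate gives the norm of the boundary kernel.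
    refine ⟨minf.star.toLp _, fun h => S.not_ae_eq_zero_χ hν0 ?_⟩
    rw [phiInf, integral_mul_eq_inner minf, inner_self_eq_zero] at h
    have h1 : star (boundaryKernelInf ν V β z) =ᵐ[μI] (0 : ℝ → ℂ) :=
      minf.star.coeFn_toLp.symm.trans (by rw [h]; exact Lp.coeFn_zero _ _ _)
    filter_upwards [h1, aeinf] with x h2 h3
    have h4 : boundaryKernelInf ν V β z x = 0 := star_eq_zero.1 h2
    rw [h4] at h3
    exact (div_eq_zero_iff.1 h3).resolve_right hWinf
  · intro f
    rw [phiZero, phiInf, ← integral_const_mul]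
    refine integral_congr_ae ?_
    filter_upwards [aeinf, aezero] with x h1 h2
    rw [← h1, ← h2, eWinf, eW, hK, Complex.ofReal_zero, mul_zero, zero_sub]
    field_simp
  · have hev : ∀ᶠ x in 𝓝[>] (0 : ℝ), x ∈ Ioc (0 : ℝ) 1 := Ioc_mem_nhdsGT one_pos
    refine ((S.isBigO₁.const_mul_left (1 / (2 * (ν : ℂ)))).add
      (S.isBigO₂.const_mul_left (S.b / (2 * ν * S.a)))).congr' (hev.mono fun x hx => ?_)
        EventuallyEq.rfl
    dsimp only
    rw [einf x hx, eWinf, hKinv, FundamentalSystem.χ]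
    field_simp
    ring
  · intro x hx x' hx'
    have h := (krein 0 hzero).2 x hx x' hx'
    rwa [hK0'] at h
  · have hKθ := (krein θ hz).1
    have e : 1 + (θ : ℂ) * K = K * (K⁻¹ + θ) := by
      rw [mul_add, mul_inv_cancel₀ hK0, mul_comm K]
    refine ⟨hKθ, by rw [e]; exact mul_ne_zero hK0 hKθ, hker hz, (krein θ hz).2, htrace θ hz, ?_⟩
    rw [operatorTrace_eq_of_apply_eq (c := (1 + (θ : ℂ) * K)⁻¹) (T' :=
      extensionResolvent ν V ((0 : ℝ) : OnePoint ℝ) β z -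
        extensionResolvent ν V OnePoint.infty β z), div_eq_inv_mul]
    intro f
    rw [hrank θ hz f, hrank 0 hzero f, hK0', e, smul_smul (K * (K⁻¹ + (θ : ℂ)))⁻¹]
    generalize K⁻¹ + (θ : ℂ) = s at hKθ
    have e' : (K * s)⁻¹ * (2 * (ν : ℂ) * K) = 2 * (ν : ℂ) * s⁻¹ := by field_simp
    rw [e']
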